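/- Let $n\ge 1$, let $\mathbb D$ be the open unit disc and $\mathbb T$ the unit circle in $\mathbb C$, and let $\mathbb G_n=\sigma(\mathbb D^n)\subset\mathbb C^n$ be the symmetrized polydisc, where $\sigma=(\sigma_1,\dots,\sigma_n)$ and $\sigma_k$ is the $k$-th elementary symmetric polynomial in $n$ variables. Let $e_1,\dots,e_n$ be the standard basis of $\mathbb C^n$, and for $X=\sum_{j=1}^n X_je_j$ put $$\rho_n(X)=\max_{\lambda\in\mathbb T}\frac1n\Bigl|\sum_{j=1}^n jX_j\lambda^{j-1}\Bigr|.$$ For a domain $D\subset\mathbb C^n$, $z\in D$ and $X\in\mathbb C^n$ let $$\kappa_D(z;X)=\inf\{|\alpha|:\alpha\in\mathbb C,\ \exists\,\varphi:\mathbb D\to D\text{ holomorphic},\ \varphi(0)=z,\ \alpha\varphi'(0)=X\},$$ $$\gamma_D(z;X)=\sup\{|f'(z)X|: f:D\to\mathbb D\text{ holomorphic},\ f(z)=0\}$$ be the Kobayashi and Carathéodory metrics, and let the Kobayashi--Buseman metric $\hat\kappa_D(z;\cdot)$ be the largest complex seminorm on $\mathbb C^n$ not exceeding $\kappa_D(z;\cdot)$.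 Let $k,l\in\{1,\dots,n\}$. (i) If $k\mid n$, then $\kappa_{\mathbb G_n}(0;e_k)=\rho_n(e_k)=k/n$. If also $l\mid n$, then $\hat\kappa_{\mathbb G_n}(0;X)=\gamma_{\mathbb G_n}(0;X)=\rho_n(X)$ for every $X\in\operatorname{span}_{\mathbb C}(e_k,e_l)$. (ii) If $n\ge 3$ and $X=X_1e_1+X_ne_n$ with $X_1\ne0$ and $X_n\neq 0$, then $\kappa_{\mathbb G_n}(0;X)>\rho_n(X)$. (iii) If $k\nmid n$, then $\gamma_{\mathbb G_n}(0;e_k)>\rho_n(e_k)$. -/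

import Mathlib

open Metric Set

noncomputable section

namespace SymmetrizedPolydisc

/-! ### Invariant metrics on a subset `D` of a complex normed space -/

section Metrics

variable {E : Type*} [NormedAddCommGroup E] [NormedSpace ℂ E]

/-- The Kobayashi(--Royden) metric: the infimum of `|α|` over all `α : ℂ` such that some holomorphic
disc `φ : 𝔻 → D` satisfies `φ 0 = z` and `α φ'(0) = X`. -/
def kobayashi (D : Set E) (z X : E) : ℝ :=
  sInf {r : ℝ | ∃ (α : ℂ) (φ : ℂ → E), DifferentiableOn ℂ φ (ball 0 1) ∧
    MapsTo φ (ball 0 1) D ∧ φ 0 = z ∧ α • deriv φ 0 = X ∧ r = ‖α‖}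

/-- The Carathéodory(--Reiffen) metric: the supremum of `|f'(z) X|` over all holomorphic
`f : D → 𝔻` with `f z = 0`. -/
def caratheodory (D : Set E) (z X : E) : ℝ :=
  sSup {r : ℝ | ∃ f : E → ℂ, DifferentiableOn ℂ f D ∧
    MapsTo f D (ball 0 1) ∧ f z = 0 ∧ r = ‖fderiv ℂ f z X‖}

/-- The Kobayashi--Buseman metric at `z`: the largest complex seminorm which does not exceed the
Kobayashi metric at `z`, i.e. the pointwise supremum of all such seminorms. -/
def kobayashiBuseman (D : Set E) (z X : E) : ℝ :=
  sSup {r : ℝ | ∃ p : Seminorm ℂ E, (∀ Y, p Y ≤ kobayashi D z Y) ∧ r = p X}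

lemma kobayashi_nonneg (D : Set E) (z X : E) : 0 ≤ kobayashi D z X := by
  apply Real.sInf_nonneg
  rintro r ⟨α, φ, -, -, -, -, rfl⟩
  exact norm_nonneg α

/-- The Kobayashi--Buseman metric is itself a seminorm, it does not exceed the Kobayashi metric,
and it is the largest such seminorm. -/
lemma kobayashiBuseman_isGreatest (D : Set E) (z : E) :
    ∃ q : Seminorm ℂ E, (∀ X, q X = kobayashiBuseman D z X) ∧
      IsGreatest {p : Seminorm ℂ E | ∀ Y, p Y ≤ kobayashi D z Y} q := by
  have bdd : ∀ X, BddAbove {r : ℝ | ∃ p : Seminorm ℂ E,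
      (∀ Y, p Y ≤ kobayashi D z Y) ∧ r = p X} := fun X =>
    ⟨kobayashi D z X, by rintro r ⟨p, hp, rfl⟩; exact hp X⟩
  have ne : ∀ X, {r : ℝ | ∃ p : Seminorm ℂ E,
      (∀ Y, p Y ≤ kobayashi D z Y) ∧ r = p X}.Nonempty := fun X =>
    ⟨0, 0, fun Y => by simpa using kobayashi_nonneg D z Y, by simp⟩
  have le : ∀ (p : Seminorm ℂ E), (∀ Y, p Y ≤ kobayashi D z Y) →
      ∀ X, p X ≤ kobayashiBuseman D z X := fun p hp X => le_csSup (bdd X) ⟨p, hp, rfl⟩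
  refine ⟨Seminorm.ofSMulLE (kobayashiBuseman D z) ?_ ?_ ?_, fun X => rfl, ?_, ?_⟩
  · refine le_antisymm (csSup_le (ne 0) ?_) ?_
    · rintro r ⟨p, -, rfl⟩
      simp
    · simpa using le 0 (fun Y => by simpa using kobayashi_nonneg D z Y) 0
  · intro x y
    refine csSup_le (ne _) ?_
    rintro r ⟨p, hp, rfl⟩
    exact (map_add_le_add p x y).trans (add_le_add (le p hp x) (le p hp y))
  · intro c x
    refine csSup_le (ne _) ?_
    rintro r ⟨p, hp, rfl⟩
    rw [map_smul_eq_mul]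
    exact mul_le_mul_of_nonneg_left (le p hp x) (norm_nonneg c)
  · intro Y
    refine csSup_le (ne Y) ?_
    rintro r ⟨p, hp, rfl⟩
    exact hp Y
  · intro p hp X
    exact le p hp X

end Metrics

/-! ### The symmetrized polydisc

Coordinates of `ℂⁿ` are indexed by `j : Fin n`; `j : Fin n` stands for the mathematical index `j + 1`. -/

/-- The symmetrization map: the component with (zero-based) index `j` is the elementary symmetric
polynomial of degree `j + 1`. -/
def sigma (n : ℕ) (z : Fin n → ℂ) : Fin n → ℂ := fun j =>
  ∑ s ∈ Finset.powersetCard ((j : ℕ) + 1) (Finset.univ : Finset (Fin n)), ∏ i ∈ s, z i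

/-- The symmetrized `n`-disc: the image of the open unit polydisc under `sigma`. -/
def symPolydisc (n : ℕ) : Set (Fin n → ℂ) :=
  sigma n '' {z | ∀ i, ‖z i‖ < 1}

/-- The standard basis vector `e_k` of `ℂⁿ`, for `1 ≤ k ≤ n`. -/
def stdVec (n k : ℕ) : Fin n → ℂ := fun j => if (j : ℕ) + 1 = k then 1 else 0

/-- The linear form `(∑_{j=1}^n j X_j t^(j-1)) / n`. -/
def linForm (n : ℕ) (t : ℂ) (X : Fin n → ℂ) : ℂ :=
  (∑ j : Fin n, (((j : ℕ) : ℂ) + 1) * X j * t ^ (j : ℕ)) / (n : ℂ)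

/-- `ρ_n(X)`, the maximum of `|linForm n t X|` over the unit circle. -/
def rho (n : ℕ) (X : Fin n → ℂ) : ℝ :=
  sSup ((fun t : ℂ => ‖linForm n t X‖) '' sphere (0 : ℂ) 1)

/-- The supremum in the definition of `rho` is a maximum. -/
lemma rho_isGreatest (n : ℕ) (X : Fin n → ℂ) :
    IsGreatest ((fun t : ℂ => ‖linForm n t X‖) '' sphere (0 : ℂ) 1) (rho n X) := by
  refine IsCompact.isGreatest_sSup ((isCompact_sphere _ _).image ?_) ?_
  · unfold linForm
    fun_prop
  · exact ⟨_, 1, by simp, rfl⟩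

end SymmetrizedPolydisc

end

/-! Write `P(t) = ∏ (1 + z_i t)`, so that the coordinates of `sigma n z` are the non-constant
coefficients of `P`. For `|t| = 1` the quotient `P'/(nP - tP')` maps the symmetrized polydisc
holomorphically into the disc (`norm_linForm_lt`), and its derivative at `0` is `linForm n t`. Hence
`rho ≤ caratheodory ≤ kobayashiBuseman ≤ kobayashi` at the origin.

For (i), if `k` divides `n`, the disc with generating polynomial `(1 + ζT^k)^(n/k)` gives the upper
bound `k/n` in direction `e_k`. Subadditivity of the Buseman metric extends this to the span of two
such vectors, where a suitable rotation of `t` makes `rho` attain the sum of the two bounds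
(`add_le_rho`).

For (iii), the power sum `p_k/n` is a competitor with derivative of modulus `k/n` at `e_k`.
Subtracting a small multiple of `∑ p_j p_{k-j}`, which is of second order at `0`, keeps this
derivative. The correction pushes the values inwards wherever `|p_k/n| = 1`: it could fail only at a
configuration of rotated `k`-th roots of unity with `p_1 = … = p_{k-1} = 0`, which would force `k ∣
n`. Compactness leaves room to rescale.

For (ii), Schwarz–Pick bounds the second Taylor coefficient of a disc composed with each quotient.
Averaging over `(n-1)`-th roots of unity reduces these bounds to a family with one common unknown
(`norm_sub_mul_add_mul_le`), and comparing two members gives a quantitative gap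
(`sq_add_mul_le_one`). -/

noncomputable section

namespace SymmetrizedPolydisc

/-! ### Comparison of the invariant metrics. -/

section Metrics

variable {E : Type*} [NormedAddCommGroup E] [NormedSpace ℂ E]

lemma norm_fderiv_apply_le {D : Set E} {z X : E} (hD : D ∈ nhds z) {f : E → ℂ}
    (hf : DifferentiableOn ℂ f D) (hfD : MapsTo f D (ball 0 1)) (hfz : f z = 0)
    {α : ℂ} {φ : ℂ → E} (hφ : DifferentiableOn ℂ φ (ball 0 1)) (hφD : MapsTo φ (ball 0 1) D)
    (hφ0 : φ 0 = z) (hX : α • deriv φ 0 = X) : ‖fderiv ℂ f z X‖ ≤ ‖α‖ := by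
  have h0 : (0 : ℂ) ∈ ball (0 : ℂ) 1 := by simp
  have hφd : HasDerivAt φ (deriv φ 0) 0 :=
    ((hφ 0 h0).differentiableAt (isOpen_ball.mem_nhds h0)).hasDerivAt
  have hfd : HasFDerivAt f (fderiv ℂ f z) (φ 0) := by
    rw [hφ0]
    exact ((hf z (mem_of_mem_nhds hD)).differentiableAt hD).hasFDerivAt
  have hc := (hfd.comp_hasDerivAt (0 : ℂ) hφd).deriv
  have hS : ‖deriv (f ∘ φ) 0‖ ≤ 1 := by
    refine Complex.norm_deriv_le_one_of_mapsTo_ball (R := 1) (c := 0) (hf.comp hφ hφD) ?_ one_pos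
    have := hfD.comp hφD
    simp only [Function.comp_apply, hφ0, hfz]
    exact this.mono_right ball_subset_closedBall
  rw [hc] at hS
  rw [← hX, map_smul, norm_smul]
  exact mul_le_of_le_one_right (norm_nonneg _) hS

lemma kobayashi_set_nonempty {D : Set E} {z : E} (hD : D ∈ nhds z) (X : E) :
    {r : ℝ | ∃ (α : ℂ) (φ : ℂ → E), DifferentiableOn ℂ φ (ball 0 1) ∧
      MapsTo φ (ball 0 1) D ∧ φ 0 = z ∧ α • deriv φ 0 = X ∧ r = ‖α‖}.Nonempty := by
  have hc : ContinuousAt (fun ζ : ℂ => z + ζ • X) 0 := by fun_prop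
  obtain ⟨ε, hε, hεD⟩ := Metric.mem_nhds_iff.1 (hc (by simpa using hD))
  have hε' : (ε : ℂ) ≠ 0 := by exact_mod_cast hε.ne'
  have hd : HasDerivAt (fun ζ : ℂ => z + (ε * ζ) • X) ((ε : ℂ) • X) 0 := by
    simpa using (((hasDerivAt_id (0 : ℂ)).const_mul (ε : ℂ)).smul_const X).const_add z
  refine ⟨_, (ε : ℂ)⁻¹, fun ζ => z + (ε * ζ) • X, by fun_prop, ?_, by simp, ?_, rfl⟩
  · intro ζ hζ
    refine hεD (show (ε * ζ : ℂ) ∈ ball 0 ε from ?_)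
    simp only [mem_ball_zero_iff, norm_mul, Complex.norm_real, Real.norm_eq_abs,
      abs_of_pos hε] at hζ ⊢
    exact mul_lt_of_lt_one_right hε hζ
  · rw [hd.deriv, smul_smul, inv_mul_cancel₀ hε', one_smul]

lemma kobayashi_le {D : Set E} {z X : E} {α : ℂ} {φ : ℂ → E}
    (hφ : DifferentiableOn ℂ φ (ball 0 1)) (hφD : MapsTo φ (ball 0 1) D)
    (hφ0 : φ 0 = z) (hX : α • deriv φ 0 = X) : kobayashi D z X ≤ ‖α‖ :=
  csInf_le ⟨0, by rintro r ⟨α, φ, -, -, -, -, rfl⟩; exact norm_nonneg α⟩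
    ⟨α, φ, hφ, hφD, hφ0, hX, rfl⟩

lemma norm_fderiv_apply_le_kobayashi {D : Set E} {z : E} (hD : D ∈ nhds z) {f : E → ℂ}
    (hf : DifferentiableOn ℂ f D) (hfD : MapsTo f D (ball 0 1)) (hfz : f z = 0) (X : E) :
    ‖fderiv ℂ f z X‖ ≤ kobayashi D z X := by
  refine le_csInf (kobayashi_set_nonempty hD X) ?_
  rintro r ⟨α, φ, hφ, hφD, hφ0, hX, rfl⟩
  exact norm_fderiv_apply_le hD hf hfD hfz hφ hφD hφ0 hX

lemma le_caratheodory {D : Set E} {z : E} (hD : D ∈ nhds z) {f : E → ℂ}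
    (hf : DifferentiableOn ℂ f D) (hfD : MapsTo f D (ball 0 1)) (hfz : f z = 0) (X : E) :
    ‖fderiv ℂ f z X‖ ≤ caratheodory D z X := by
  refine le_csSup ⟨kobayashi D z X, ?_⟩ ⟨f, hf, hfD, hfz, rfl⟩
  rintro r ⟨f, hf, hfD, hfz, rfl⟩
  exact norm_fderiv_apply_le_kobayashi hD hf hfD hfz X

/-- Each competitor `f` yields a seminorm `|f'(z) ·|`, which lies below the Kobayashi metric by the
Schwarz lemma. -/
lemma caratheodory_le_kobayashiBuseman {D : Set E} {z : E} (hD : D ∈ nhds z) (X : E) :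
    caratheodory D z X ≤ kobayashiBuseman D z X := by
  obtain ⟨q, hq, -, hmax⟩ := kobayashiBuseman_isGreatest D z
  refine csSup_le ⟨0, fun _ => 0, by fun_prop, fun _ _ => by simp, rfl, by simp⟩ ?_
  rintro r ⟨f, hf, hfD, hfz, rfl⟩
  rw [← hq]
  exact hmax (a := (normSeminorm ℂ ℂ).comp (fderiv ℂ f z).toLinearMap)
    (fun Y => norm_fderiv_apply_le_kobayashi hD hf hfD hfz Y) X

lemma kobayashiBuseman_le_kobayashi (D : Set E) (z X : E) :
    kobayashiBuseman D z X ≤ kobayashi D z X := by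
  obtain ⟨q, hq, hle, -⟩ := kobayashiBuseman_isGreatest D z
  rw [← hq]
  exact hle X

lemma kobayashiBuseman_smul_add_smul_le (D : Set E) (z : E) (a b : ℂ) (X Y : E) :
    kobayashiBuseman D z (a • X + b • Y) ≤ ‖a‖ * kobayashi D z X + ‖b‖ * kobayashi D z Y := by
  obtain ⟨q, hq, hle, -⟩ := kobayashiBuseman_isGreatest D z
  rw [← hq]
  refine (map_add_le_add q _ _).trans ?_
  rw [map_smul_eq_mul, map_smul_eq_mul]
  exact add_le_add (mul_le_mul_of_nonneg_left (hle X) (norm_nonneg _))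
    (mul_le_mul_of_nonneg_left (hle Y) (norm_nonneg _))

end Metrics

/-! ### Elementary symmetric polynomials and the roots of the generating polynomial -/

variable {n : ℕ}

lemma prod_one_add_mul (z : Fin n → ℂ) (t : ℂ) :
    ∏ i, (1 + z i * t) = 1 + ∑ j : Fin n, sigma n z j * t ^ ((j : ℕ) + 1) := by
  rw [Finset.prod_one_add, Finset.sum_powerset, Finset.card_univ, Fintype.card_fin,
    Finset.sum_range_succ', add_comm, Finset.sum_range]
  congr 1
  · simp
  · refine Finset.sum_congr rfl fun j _ => ?_
    rw [sigma, Finset.sum_mul]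
    refine Finset.sum_congr rfl fun s hs => ?_
    rw [Finset.prod_mul_distrib, Finset.prod_const, (Finset.mem_powersetCard.1 hs).2]

/-- The non-constant part of the denominator of the rational functions mapping the symmetrized
polydisc to the disc. -/
def auxForm (n : ℕ) (t : ℂ) (X : Fin n → ℂ) : ℂ :=
  (∑ j : Fin n, ((n : ℂ) - ((j : ℂ) + 1)) * X j * t ^ ((j : ℕ) + 1)) / (n : ℂ)

lemma mul_linForm_sigma (hn : n ≠ 0) (z : Fin n → ℂ) (t : ℂ) :
    n * linForm n t (sigma n z) = ∑ i, z i * ∏ l ∈ Finset.univ.erase i, (1 + z l * t) := by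
  have hn' : (n : ℂ) ≠ 0 := by exact_mod_cast hn
  have h1 : HasDerivAt (fun t : ℂ => ∏ i, (1 + z i * t))
      (∑ i, (∏ l ∈ Finset.univ.erase i, (1 + z l * t)) • z i) t := by
    refine HasDerivAt.fun_finsetProd fun i _ => ?_
    simpa using ((hasDerivAt_id t).const_mul (z i)).const_add 1
  have h2 : HasDerivAt (fun t : ℂ => 1 + ∑ j : Fin n, sigma n z j * t ^ ((j : ℕ) + 1))
      (∑ j : Fin n, sigma n z j * (((j : ℕ) + 1 : ℕ) * t ^ (j : ℕ))) t := by
    refine (HasDerivAt.fun_sum fun j _ => ?_).const_add 1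
    simpa using (hasDerivAt_pow ((j : ℕ) + 1) t).const_mul (sigma n z j)
  have h3 := h1.unique (h2.congr_of_eventuallyEq
    (Filter.Eventually.of_forall fun t => prod_one_add_mul z t))
  rw [linForm, mul_div_cancel₀ _ hn']
  calc _ = ∑ j : Fin n, sigma n z j * (((j : ℕ) + 1 : ℕ) * t ^ (j : ℕ)) :=
        Finset.sum_congr rfl fun j _ => by push_cast; ring
    _ = _ := by rw [← h3]; exact Finset.sum_congr rfl fun j _ => by rw [smul_eq_mul, mul_comm]

/-- This is `nP - tP'`, the numerator of the polar derivative of the generating polynomial. -/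
lemma mul_one_add_auxForm (hn : n ≠ 0) (X : Fin n → ℂ) (t : ℂ) :
    n * (1 + auxForm n t X) =
      n * (1 + ∑ j : Fin n, X j * t ^ ((j : ℕ) + 1)) - t * (n * linForm n t X) := by
  have hn' : (n : ℂ) ≠ 0 := by exact_mod_cast hn
  rw [linForm, auxForm, mul_add, mul_add, mul_div_cancel₀ _ hn', mul_div_cancel₀ _ hn', mul_one,
    add_sub_assoc, Finset.mul_sum, Finset.mul_sum, ← Finset.sum_sub_distrib]
  congr 1
  exact Finset.sum_congr rfl fun j _ => by ring

lemma mul_one_add_auxForm_sigma (hn : n ≠ 0) (z : Fin n → ℂ) (t : ℂ) :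
    n * (1 + auxForm n t (sigma n z)) = ∑ i, ∏ l ∈ Finset.univ.erase i, (1 + z l * t) := by
  rw [mul_one_add_auxForm hn, ← prod_one_add_mul, mul_linForm_sigma hn, Finset.mul_sum,
    eq_comm, eq_sub_iff_add_eq, ← Finset.sum_add_distrib]
  calc _ = ∑ i : Fin n, ∏ i, (1 + z i * t) := by
        refine Finset.sum_congr rfl fun i _ => ?_
        rw [← Finset.mul_prod_erase _ _ (Finset.mem_univ i)]
        ring
    _ = _ := by simp

/-- With `S = ∑ (1 + z_i t)⁻¹` one has `tP' = P(n - S)` and `nP - tP' = PS`. Inversion sends the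
disc `|w - 1| < 1` to the half-plane `Re > 1/2`, so `Re S > n/2`, and `S` is farther from `0` than
from `n`. -/
lemma norm_linForm_lt (hn : n ≠ 0) {t : ℂ} (ht : ‖t‖ = 1) {s : Fin n → ℂ}
    (hs : s ∈ symPolydisc n) : ‖linForm n t s‖ < ‖1 + auxForm n t s‖ := by
  obtain ⟨z, hz, rfl⟩ := hs
  have hn' : (0 : ℝ) < ‖(n : ℂ)‖ := by simpa using Nat.pos_of_ne_zero hn
  have hlt : ∀ i, ‖z i * t‖ < 1 := fun i => by simpa [ht] using hz i
  have hne : ∀ i, 1 + z i * t ≠ 0 := fun i h => by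
    have := hlt i
    rw [eq_neg_of_add_eq_zero_right h] at this
    simp at this
  have hP : ∏ i, (1 + z i * t) ≠ 0 := Finset.prod_ne_zero_iff.2 fun i _ => hne i
  have herase : ∀ i, ∏ l ∈ Finset.univ.erase i, (1 + z l * t) =
      (∏ i, (1 + z i * t)) * (1 + z i * t)⁻¹ := fun i => by
    rw [← Finset.mul_prod_erase _ _ (Finset.mem_univ i), mul_comm, ← mul_assoc,
      inv_mul_cancel₀ (hne i), one_mul]
  have hre : ∀ i, 1 / 2 < ((1 + z i * t)⁻¹).re := fun i => by
    have h1 : 0 < Complex.normSq (1 + z i * t) := Complex.normSq_pos.2 (hne i)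
    have h2 : Complex.normSq (z i * t) < 1 := by
      rw [Complex.normSq_eq_norm_sq]
      have := hlt i
      have := norm_nonneg (z i * t)
      nlinarith
    rw [Complex.inv_re, lt_div_iff₀ h1]
    rw [Complex.normSq_apply] at h2 ⊢
    simp only [Complex.add_re, Complex.add_im, Complex.one_re, Complex.one_im]
    nlinarith
  refine lt_of_mul_lt_mul_left ?_ hn'.le
  rw [← norm_mul, ← norm_mul, mul_linForm_sigma hn, mul_one_add_auxForm_sigma hn]
  have e1 : ‖∑ i, z i * ∏ l ∈ Finset.univ.erase i, (1 + z l * t)‖ =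
      ‖∏ i, (1 + z i * t)‖ * ‖(n : ℂ) - ∑ i, (1 + z i * t)⁻¹‖ := by
    rw [← one_mul ‖∑ i, _‖, ← ht, ← norm_mul, ← norm_mul]
    congr 1
    have : (n : ℂ) = ∑ i : Fin n, 1 := by simp
    rw [this, ← Finset.sum_sub_distrib, Finset.mul_sum, Finset.mul_sum]
    refine Finset.sum_congr rfl fun i _ => ?_
    rw [herase]
    have := mul_inv_cancel₀ (hne i)
    linear_combination (∏ i, (1 + z i * t)) * this
  have e2 : ‖∑ i, ∏ l ∈ Finset.univ.erase i, (1 + z l * t)‖ =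
      ‖∏ i, (1 + z i * t)‖ * ‖∑ i, (1 + z i * t)⁻¹‖ := by
    rw [← norm_mul, Finset.mul_sum]
    simp_rw [herase]
  rw [e1, e2]
  refine mul_lt_mul_of_pos_left ?_ (norm_pos_iff.2 hP)
  have hS : (n : ℝ) / 2 < (∑ i, (1 + z i * t)⁻¹).re := by
    rw [Complex.re_sum]
    have : NeZero n := ⟨hn⟩
    calc (n : ℝ) / 2 = ∑ i : Fin n, 1 / 2 := by simp; ring
      _ < _ := Finset.sum_lt_sum_of_nonempty Finset.univ_nonempty fun i _ => hre i
  have hn0 : (0 : ℝ) < n := by exact_mod_cast Nat.pos_of_ne_zero hn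
  rw [Complex.norm_def, Complex.norm_def]
  refine Real.sqrt_lt_sqrt (Complex.normSq_nonneg _) ?_
  rw [Complex.normSq_apply, Complex.normSq_apply]
  simp only [Complex.sub_re, Complex.sub_im, Complex.natCast_re, Complex.natCast_im]
  nlinarith

open Polynomial in
-- Vieta: the `-z i` are the roots, with multiplicity, of the monic polynomial with coefficients
-- `s`.
lemma exists_sigma_eq_eval (s : Fin n → ℂ) : ∃ z : Fin n → ℂ, sigma n z = s ∧
    ∀ i, (-z i) ^ n + ∑ j : Fin n, s j * (-z i) ^ (n - ((j : ℕ) + 1)) = 0 := by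
  set R : ℂ[X] := ∑ j : Fin n, C (s j) * X ^ (n - ((j : ℕ) + 1)) with hR
  set Q : ℂ[X] := X ^ n + R with hQ
  have hRdeg : R.degree < n := by
    refine (degree_sum_le _ _).trans_lt ((Finset.sup_lt_iff (WithBot.bot_lt_coe n)).2 ?_)
    intro j _
    refine (degree_C_mul_X_pow_le _ _).trans_lt ?_
    have := j.2
    exact Nat.cast_lt.2 (by omega : n - ((j : ℕ) + 1) < n)
  have hmonic : Q.Monic := monic_X_pow_add hRdeg
  have hdeg : Q.natDegree = n := by
    apply natDegree_eq_of_degree_eq_some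
    rw [hQ, degree_add_eq_left_of_degree_lt (by rwa [degree_X_pow]), degree_X_pow]
  have hsplit : Q.Splits := IsAlgClosed.splits Q
  have hcard : Multiset.card Q.roots = n := by rw [splits_iff_card_roots.1 hsplit, hdeg]
  obtain ⟨z, hz⟩ : ∃ z : Fin n → ℂ, Q.roots = Finset.univ.val.map fun i => -z i := by
    obtain ⟨l, hl⟩ := Quot.exists_rep Q.roots
    have hl' : Q.roots = (l : Multiset ℂ) := hl.symm
    rw [hl', Multiset.coe_card] at hcard
    subst hcard
    refine ⟨fun i => -l.get i, ?_⟩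
    rw [hl', Fin.univ_val_map]
    simp
  have hprod : Q = ∏ i, (X + C (z i)) := by
    rw [hsplit.eq_prod_roots_of_monic hmonic, hz, Multiset.map_map, Finset.prod]
    simp
  refine ⟨z, ?_, fun i => ?_⟩
  · funext j
    have hj : (j : ℕ) + 1 ≤ n := j.2
    have h1 : Q.coeff (n - ((j : ℕ) + 1)) = sigma n z j := by
      rw [hprod, Finset.prod_X_add_C_coeff _ _ (by simp), sigma, Finset.card_univ,
        Fintype.card_fin, Nat.sub_sub_self hj]
    rw [← h1, hQ, hR, coeff_add, coeff_X_pow, if_neg (by omega), zero_add, finsetSum_coeff,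
      Finset.sum_eq_single j]
    · simp
    · intro i _ hij
      rw [coeff_C_mul, coeff_X_pow, if_neg, mul_zero]
      intro h
      have := i.2
      exact hij (Fin.ext (by omega))
    · simp
  · have h0 : Q.eval (-z i) = 0 := by
      rw [hprod, eval_prod]
      exact Finset.prod_eq_zero (Finset.mem_univ i) (by simp)
    simpa [hQ, hR, eval_finsetSum] using h0

/-- The generating polynomial is the reversal of the monic one, so a root `-z i` outside the open
disc would give the zero `(-z i)⁻¹` in the closed disc. -/
lemma mem_symPolydisc_of_forall_ne_zero {s : Fin n → ℂ}
    (h : ∀ t : ℂ, ‖t‖ ≤ 1 → 1 + ∑ j : Fin n, s j * t ^ ((j : ℕ) + 1) ≠ 0) :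
    s ∈ symPolydisc n := by
  obtain ⟨z, hzs, hz⟩ := exists_sigma_eq_eval s
  refine ⟨z, fun i => ?_, hzs⟩
  by_contra! hi
  have hzi : -z i ≠ 0 := fun h0 => by
    rw [neg_eq_zero.1 h0, norm_zero] at hi
    linarith
  refine h (-z i)⁻¹ ?_ ?_
  · rw [norm_inv, norm_neg]
    exact inv_le_one_of_one_le₀ hi
  · have h1 : (-z i) ^ n ≠ 0 := pow_ne_zero _ hzi
    refine (mul_eq_zero.1 ?_).resolve_left h1
    rw [← hz i, mul_add, mul_one, Finset.mul_sum]
    congr 1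
    refine Finset.sum_congr rfl fun j _ => ?_
    have hj : (j : ℕ) + 1 ≤ n := j.2
    rw [pow_sub₀ _ hzi hj, inv_pow]
    ring

lemma symPolydisc_mem_nhds (n : ℕ) : symPolydisc n ∈ nhds (0 : Fin n → ℂ) := by
  -- This radius bounds the non-constant part by `n/(n+1) < 1`.
  refine Metric.mem_nhds_iff.2 ⟨1 / (n + 1), by positivity, fun s hs => ?_⟩
  rw [mem_ball_zero_iff] at hs
  refine mem_symPolydisc_of_forall_ne_zero fun t ht h => ?_
  have h1 : ‖∑ j : Fin n, s j * t ^ ((j : ℕ) + 1)‖ ≤ ∑ j : Fin n, 1 / ((n : ℝ) + 1) := by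
    refine norm_sum_le_of_le _ fun j _ => ?_
    rw [norm_mul, norm_pow]
    calc ‖s j‖ * ‖t‖ ^ ((j : ℕ) + 1) ≤ ‖s‖ * 1 :=
          mul_le_mul (norm_le_pi_norm s j) (pow_le_one₀ (norm_nonneg _) ht) (by positivity)
            (norm_nonneg _)
      _ ≤ _ := by rw [mul_one]; exact hs.le
  rw [eq_neg_of_add_eq_zero_right h, norm_neg, norm_one, Finset.sum_const, Finset.card_univ,
    Fintype.card_fin, nsmul_eq_mul, mul_one_div, le_div_iff₀ (by positivity)] at h1
  linarith

lemma zero_mem_symPolydisc (n : ℕ) : (0 : Fin n → ℂ) ∈ symPolydisc n :=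
  mem_of_mem_nhds (symPolydisc_mem_nhds n)

/-! ### The lower bound for the Carathéodory metric. -/

lemma linForm_zero (n : ℕ) (t : ℂ) : linForm n t 0 = 0 := by simp [linForm]

lemma auxForm_zero (n : ℕ) (t : ℂ) : auxForm n t 0 = 0 := by simp [auxForm]

lemma differentiable_linForm (n : ℕ) (t : ℂ) : Differentiable ℂ (linForm n t) := by
  unfold linForm
  fun_prop

lemma differentiable_auxForm (n : ℕ) (t : ℂ) : Differentiable ℂ (auxForm n t) := by
  unfold auxForm
  fun_prop

lemma one_add_auxForm_ne_zero (hn : n ≠ 0) {t : ℂ} (ht : ‖t‖ = 1) {s : Fin n → ℂ}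
    (hs : s ∈ symPolydisc n) : 1 + auxForm n t s ≠ 0 :=
  norm_pos_iff.1 ((norm_nonneg _).trans_lt (norm_linForm_lt hn ht hs))

lemma norm_linForm_le_caratheodory (hn : n ≠ 0) {t : ℂ} (ht : ‖t‖ = 1) (X : Fin n → ℂ) :
    ‖linForm n t X‖ ≤ caratheodory (symPolydisc n) 0 X := by
  set f : (Fin n → ℂ) → ℂ := fun s => linForm n t s / (1 + auxForm n t s) with hf
  have hd : DifferentiableOn ℂ f (symPolydisc n) := by
    simp only [hf, div_eq_mul_inv]
    exact (differentiable_linForm n t).differentiableOn.fun_mul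
      (((differentiable_auxForm n t).const_add 1).differentiableOn.fun_inv
        fun s hs => one_add_auxForm_ne_zero hn ht hs)
  have h0 : f 0 = 0 := by simp [hf, linForm_zero]
  have hlin : HasDerivAt (fun ζ : ℂ => f (ζ • X)) (linForm n t X) 0 := by
    have hL : ∀ ζ : ℂ, linForm n t (ζ • X) = ζ * linForm n t X := fun ζ => by
      simp only [linForm, Pi.smul_apply, smul_eq_mul, ← mul_div_assoc, Finset.mul_sum]
      congr 1
      exact Finset.sum_congr rfl fun j _ => by ring
    have hM : DifferentiableAt ℂ (fun ζ : ℂ => 1 + auxForm n t (ζ • X)) 0 :=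
      ((differentiable_auxForm n t).comp (differentiable_id.smul_const X)).differentiableAt.const_add 1
    have h := (((hasDerivAt_id (0 : ℂ)).mul_const (linForm n t X)).fun_div hM.hasDerivAt
      (by simp [auxForm_zero]))
    simpa [hf, hL, auxForm_zero] using h
  have hfd : HasFDerivAt f (fderiv ℂ f 0) ((0 : ℂ) • X) := by
    rw [zero_smul]
    exact ((hd 0 (zero_mem_symPolydisc n)).differentiableAt (symPolydisc_mem_nhds n)).hasFDerivAt
  have hc : HasDerivAt (fun ζ : ℂ => f (ζ • X)) (fderiv ℂ f 0 X) 0 := by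
    simpa [Function.comp_def] using hfd.comp_hasDerivAt (0 : ℂ) ((hasDerivAt_id (0 : ℂ)).smul_const X)
  rw [hlin.unique hc]
  refine le_caratheodory (symPolydisc_mem_nhds n) hd (fun s hs => ?_) h0 X
  rw [mem_ball_zero_iff, hf, norm_div]
  have h := norm_linForm_lt hn ht hs
  exact (div_lt_one ((norm_nonneg _).trans_lt h)).2 h

lemma rho_le_caratheodory (hn : n ≠ 0) (X : Fin n → ℂ) :
    rho n X ≤ caratheodory (symPolydisc n) 0 X := by
  obtain ⟨t, ht, h⟩ := (rho_isGreatest n X).1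
  rw [← h]
  exact norm_linForm_le_caratheodory hn (by simpa using ht) X

lemma norm_linForm_le_rho (n : ℕ) {t : ℂ} (ht : ‖t‖ = 1) (X : Fin n → ℂ) :
    ‖linForm n t X‖ ≤ rho n X :=
  (rho_isGreatest n X).2 ⟨t, by simpa using ht, rfl⟩

lemma linForm_stdVec {k : ℕ} (hk : 1 ≤ k) (hkn : k ≤ n) (t : ℂ) :
    linForm n t (stdVec n k) = k * t ^ (k - 1) / n := by
  rw [linForm, Finset.sum_eq_single ⟨k - 1, by omega⟩]
  · simp [stdVec, Nat.cast_sub hk, Nat.sub_add_cancel hk]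
  · intro j _ hj
    rw [stdVec, if_neg, mul_zero, zero_mul]
    intro h
    exact hj (Fin.ext (by simp; omega))
  · simp

lemma rho_stdVec {k : ℕ} (hk : 1 ≤ k) (hkn : k ≤ n) : rho n (stdVec n k) = k / n := by
  obtain ⟨t, ht, h⟩ := (rho_isGreatest n (stdVec n k)).1
  rw [← h]
  simp only [mem_sphere_iff_norm, sub_zero] at ht
  simp [linForm_stdVec hk hkn, ht]

lemma linForm_add (n : ℕ) (t : ℂ) (X Y : Fin n → ℂ) :
    linForm n t (X + Y) = linForm n t X + linForm n t Y := by
  simp only [linForm, Pi.add_apply, ← add_div, ← Finset.sum_add_distrib]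
  congr 1
  exact Finset.sum_congr rfl fun j _ => by ring

lemma linForm_smul (n : ℕ) (t a : ℂ) (X : Fin n → ℂ) :
    linForm n t (a • X) = a * linForm n t X := by
  simp only [linForm, Pi.smul_apply, smul_eq_mul, ← mul_div_assoc, Finset.mul_sum]
  congr 1
  exact Finset.sum_congr rfl fun j _ => by ring

/-! ### Discs in the directions `e_k` with `k ∣ n`, and the Buseman metric on their spans. -/

/-- The holomorphic disc whose value at `ζ` corresponds to the generating polynomial
`(1 + ζ T ^ k) ^ d`. -/
def powDisc (n k d : ℕ) (ζ : ℂ) : Fin n → ℂ := fun j =>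
  if k ∣ (j : ℕ) + 1 then (d.choose (((j : ℕ) + 1) / k) : ℂ) * ζ ^ (((j : ℕ) + 1) / k) else 0

lemma one_add_sum_powDisc {k d : ℕ} (hk : 1 ≤ k) (h : n = k * d) (ζ t : ℂ) :
    1 + ∑ j : Fin n, powDisc n k d ζ j * t ^ ((j : ℕ) + 1) = (1 + ζ * t ^ k) ^ d := by
  have e : (1 + ζ * t ^ k) ^ d =
      ∑ i ∈ Finset.range (d + 1), (d.choose i : ℂ) * ζ ^ i * t ^ (k * i) := by
    rw [add_comm, add_pow]
    exact Finset.sum_congr rfl fun i _ => by rw [mul_pow, pow_mul, one_pow]; ring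
  rw [e, Finset.sum_range_succ', add_comm]
  congr 1
  · rw [Finset.sum_range fun i => (d.choose (i + 1) : ℂ) * ζ ^ (i + 1) * t ^ (k * (i + 1))]
    symm
    have hlt : ∀ i : Fin d, k * ((i : ℕ) + 1) ≤ n := fun i => h ▸ Nat.mul_le_mul_left k i.2
    have hsub : ∀ i : Fin d, k * ((i : ℕ) + 1) - 1 + 1 = k * ((i : ℕ) + 1) := fun i =>
      Nat.sub_add_cancel (Nat.mul_pos hk (Nat.succ_pos _))
    refine Finset.sum_of_injOn
      (fun i : Fin d => (⟨k * ((i : ℕ) + 1) - 1, by have := hlt i; have := hsub i; omega⟩ : Fin n))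
      ?_ (fun _ _ => Finset.mem_coe.2 (Finset.mem_univ _)) ?_ ?_
    · intro i _ i' _ hii
      have h1 : k * ((i : ℕ) + 1) = k * ((i' : ℕ) + 1) := by
        rw [← hsub i, ← hsub i']
        exact congrArg (· + 1) (Fin.mk.inj_iff.1 hii)
      exact Fin.ext (Nat.succ_injective (Nat.eq_of_mul_eq_mul_left hk h1))
    · intro j _ hj
      rw [powDisc, if_neg, zero_mul]
      rintro ⟨i, hi⟩
      have hj2 := j.2
      have hi0 : i ≠ 0 := by rintro rfl; simp at hi
      have hid : i ≤ d := Nat.le_of_mul_le_mul_left (by omega : k * i ≤ k * d) hk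
      refine hj ⟨⟨i - 1, by omega⟩, Finset.mem_coe.2 (Finset.mem_univ _), Fin.ext ?_⟩
      simp only [Nat.sub_add_cancel (Nat.one_le_iff_ne_zero.2 hi0)]
      omega
    · intro i _
      simp only [powDisc, hsub, dvd_mul_right, if_true, Nat.mul_div_cancel_left _ hk]
  · simp

lemma kobayashi_stdVec_le {k : ℕ} (hn : n ≠ 0) (hkn : k ∣ n) :
    kobayashi (symPolydisc n) 0 (stdVec n k) ≤ k / n := by
  obtain ⟨d, hd⟩ := hkn
  have hk : 1 ≤ k := Nat.one_le_iff_ne_zero.2 (by rintro rfl; simp at hd; exact hn hd)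
  have hd0 : d ≠ 0 := by rintro rfl; simp at hd; exact hn hd
  have hdC : (d : ℂ) ≠ 0 := by exact_mod_cast hd0
  have hder : HasDerivAt (powDisc n k d) ((d : ℂ) • stdVec n k) 0 := by
    refine hasDerivAt_pi.2 fun j => ?_
    simp only [powDisc, stdVec, Pi.smul_apply, smul_eq_mul]
    by_cases hj : k ∣ (j : ℕ) + 1
    · simp only [if_pos hj]
      obtain ⟨i, hi⟩ := hj
      rw [hi, Nat.mul_div_cancel_left _ hk]
      have hi0 : i ≠ 0 := by rintro rfl; simp at hi
      refine ((hasDerivAt_pow i (0 : ℂ)).const_mul (d.choose i : ℂ)).congr_deriv ?_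
      -- Only the coefficient of `T^k` is linear in `ζ`; the others vanish to higher order.
      rcases eq_or_ne i 1 with rfl | hi1
      · simp
      · rw [if_neg (fun h => hi1 (Nat.eq_of_mul_eq_mul_left hk (by omega))),
          zero_pow (by omega)]
        simp
    · simp only [if_neg hj]
      rw [if_neg (fun h : (j : ℕ) + 1 = k => hj (h ▸ dvd_rfl)), mul_zero]
      exact hasDerivAt_const _ _
  have hnorm : ‖((d : ℂ))⁻¹‖ = (k : ℝ) / n := by
    have hkR : (k : ℝ) ≠ 0 := by exact_mod_cast (by omega : k ≠ 0)
    rw [hd, norm_inv, Complex.norm_natCast]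
    push_cast
    field_simp
  rw [← hnorm]
  refine kobayashi_le (φ := powDisc n k d) ?_ (fun ζ hζ => ?_) ?_ ?_
  · refine differentiableOn_pi.2 fun j => ?_
    unfold powDisc
    split_ifs <;> fun_prop
  · refine mem_symPolydisc_of_forall_ne_zero fun t ht => ?_
    rw [one_add_sum_powDisc hk hd]
    refine pow_ne_zero _ fun h => ?_
    have h1 : ‖ζ * t ^ k‖ < 1 := by
      rw [norm_mul, norm_pow]
      exact (mul_le_of_le_one_right (norm_nonneg _)
        (pow_le_one₀ (norm_nonneg _) ht)).trans_lt (by simpa using hζ)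
    rw [eq_neg_of_add_eq_zero_right h] at h1
    simp at h1
  · funext j
    simp only [powDisc, Pi.zero_apply, ite_eq_right_iff]
    rintro ⟨i, hi⟩
    rw [hi, Nat.mul_div_cancel_left _ hk, zero_pow, mul_zero]
    rintro rfl
    simp at hi
  · rw [hder.deriv, smul_smul, inv_mul_cancel₀ hdC, one_smul]

lemma kobayashi_stdVec {k : ℕ} (hn : n ≠ 0) (hkn : k ∣ n) :
    kobayashi (symPolydisc n) 0 (stdVec n k) = rho n (stdVec n k) ∧
      rho n (stdVec n k) = (k : ℝ) / n := by
  have hr := rho_stdVec (Nat.pos_of_dvd_of_pos hkn (Nat.pos_of_ne_zero hn))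
    (Nat.le_of_dvd (Nat.pos_of_ne_zero hn) hkn)
  refine ⟨le_antisymm (hr ▸ kobayashi_stdVec_le hn hkn) ?_, hr⟩
  exact (rho_le_caratheodory hn _).trans ((caratheodory_le_kobayashiBuseman
    (symPolydisc_mem_nhds n) _).trans (kobayashiBuseman_le_kobayashi _ _ _))

lemma exists_norm_eq_one_pow_mul {m : ℕ} (hm : m ≠ 0) (w : ℂ) :
    ∃ μ : ℂ, ‖μ‖ = 1 ∧ μ ^ m * w = ‖w‖ := by
  rcases eq_or_ne w 0 with rfl | hw
  · exact ⟨1, by simp, by simp⟩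
  have hw' : (‖w‖ : ℂ) ≠ 0 := by simpa using hw
  obtain ⟨μ, hμ⟩ := IsAlgClosed.exists_pow_nat_eq (‖w‖ / w : ℂ) (Nat.pos_of_ne_zero hm)
  refine ⟨μ, ?_, by rw [hμ, div_mul_cancel₀ _ hw]⟩
  refine (pow_eq_one_iff_of_nonneg (norm_nonneg _) hm).1 ?_
  rw [← norm_pow, hμ, norm_div, Complex.norm_real, norm_norm, div_self (norm_ne_zero_iff.2 hw)]

/-- Two complex numbers, one multiplied by a nontrivial power of a unimodular number,
can be aligned. -/
lemma exists_norm_add_pow_mul {m : ℕ} (hm : m ≠ 0) (a b : ℂ) :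
    ∃ μ : ℂ, ‖μ‖ = 1 ∧ ‖a + b * μ ^ m‖ = ‖a‖ + ‖b‖ := by
  rcases eq_or_ne a 0 with rfl | ha
  · exact ⟨1, by simp, by simp⟩
  obtain ⟨μ, hμ, h⟩ := exists_norm_eq_one_pow_mul hm (b / a)
  refine ⟨μ, hμ, ?_⟩
  have e : a + b * μ ^ m = a * ((1 + ‖b / a‖ : ℝ) : ℂ) := by
    push_cast
    rw [← h]
    field_simp
  rw [e, norm_mul, Complex.norm_real, Real.norm_of_nonneg (by positivity), norm_div]
  have := norm_ne_zero_iff.2 ha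
  field_simp

/-- Up to the unimodular factor `μ^(k-1)`, the two terms differ in phase by a nontrivial power of
`μ`, so some `μ` aligns them. -/
lemma add_le_rho_of_lt {k l : ℕ} (hk : 1 ≤ k) (hkl : k < l) (hl : l ≤ n) (a b : ℂ) :
    ‖a‖ * (k / n) + ‖b‖ * (l / n) ≤ rho n (a • stdVec n k + b • stdVec n l) := by
  obtain ⟨μ, hμ, h⟩ := exists_norm_add_pow_mul (by omega : l - k ≠ 0) (a * (k / n)) (b * (l / n))
  refine le_trans (le_of_eq ?_) (norm_linForm_le_rho n hμ _)
  have e : linForm n μ (a • stdVec n k + b • stdVec n l) =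
      μ ^ (k - 1) * (a * (k / n) + b * (l / n) * μ ^ (l - k)) := by
    rw [linForm_add, linForm_smul, linForm_smul, linForm_stdVec hk (by omega),
      linForm_stdVec (by omega) hl, (by omega : l - 1 = (k - 1) + (l - k)), pow_add]
    ring
  rw [e, norm_mul, norm_pow, hμ, one_pow, one_mul, h]
  simp

lemma add_le_rho {k l : ℕ} (hk : 1 ≤ k) (hkn : k ≤ n) (hl : 1 ≤ l) (hln : l ≤ n) (hkl : k ≠ l)
    (a b : ℂ) :
    ‖a‖ * (k / n) + ‖b‖ * (l / n) ≤ rho n (a • stdVec n k + b • stdVec n l) := by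
  rcases lt_or_gt_of_ne hkl with h | h
  · exact add_le_rho_of_lt hk h hln a b
  · rw [add_comm, add_comm (a • _)]
    exact add_le_rho_of_lt hl h hkn b a

lemma kobayashiBuseman_le_rho {k l : ℕ} (hn : n ≠ 0) (hk : k ∣ n) (hl : l ∣ n) {X : Fin n → ℂ}
    (hX : X ∈ Submodule.span ℂ ({stdVec n k, stdVec n l} : Set (Fin n → ℂ))) :
    kobayashiBuseman (symPolydisc n) 0 X ≤ rho n X := by
  have hn0 := Nat.pos_of_ne_zero hn
  have hk1 := Nat.pos_of_dvd_of_pos hk hn0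
  have hl1 := Nat.pos_of_dvd_of_pos hl hn0
  have hkn := Nat.le_of_dvd hn0 hk
  have hln := Nat.le_of_dvd hn0 hl
  obtain ⟨a, b, rfl⟩ := Submodule.mem_span_pair.1 hX
  -- When `k = l` there is no phase to adjust, and the coefficients are added first.
  rcases eq_or_ne k l with rfl | hkl
  · have h := kobayashiBuseman_smul_add_smul_le (symPolydisc n) 0 (a + b) 0 (stdVec n k) 0
    simp only [smul_zero, add_zero, norm_zero, zero_mul] at h
    rw [← add_smul]
    refine h.trans ((mul_le_mul_of_nonneg_left (kobayashi_stdVec_le hn hk)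
      (norm_nonneg _)).trans (le_of_eq_of_le ?_ (norm_linForm_le_rho n (t := 1) (by simp) _)))
    rw [linForm_smul, linForm_stdVec hk1 hkn]
    simp
  · refine (kobayashiBuseman_smul_add_smul_le _ _ a b _ _).trans (le_trans ?_
      (add_le_rho hk1 hkn hl1 hln hkl a b))
    exact add_le_add
      (mul_le_mul_of_nonneg_left (kobayashi_stdVec_le hn hk) (norm_nonneg _))
      (mul_le_mul_of_nonneg_left (kobayashi_stdVec_le hn hl) (norm_nonneg _))

lemma kobayashiBuseman_eq_caratheodory_eq_rho {k l : ℕ} (hn : n ≠ 0) (hk : k ∣ n) (hl : l ∣ n)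
    {X : Fin n → ℂ}
    (hX : X ∈ Submodule.span ℂ ({stdVec n k, stdVec n l} : Set (Fin n → ℂ))) :
    kobayashiBuseman (symPolydisc n) 0 X = caratheodory (symPolydisc n) 0 X ∧
      caratheodory (symPolydisc n) 0 X = rho n X := by
  have h1 := kobayashiBuseman_le_rho hn hk hl hX
  have h2 := rho_le_caratheodory hn X
  have h3 := caratheodory_le_kobayashiBuseman (symPolydisc_mem_nhds n) X
  exact ⟨le_antisymm (h1.trans h2) h3, le_antisymm (h3.trans h1) h2⟩

/-! ### Power sums as functions on the symmetrized polydisc -/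

/-- The coordinate carrying the elementary symmetric polynomial of degree `k`; it is zero if there
is no such coordinate. -/
def coord (n k : ℕ) : (Fin n → ℂ) →L[ℂ] ℂ :=
  ∑ j : Fin n, if (j : ℕ) + 1 = k then ContinuousLinearMap.proj j else 0

lemma coord_apply {k : ℕ} (hk : 1 ≤ k) (hkn : k ≤ n) (s : Fin n → ℂ) :
    coord n k s = s ⟨k - 1, by omega⟩ := by
  rw [coord, Finset.sum_eq_single ⟨k - 1, by omega⟩]
  · rw [if_pos (Nat.sub_add_cancel hk)]
    rfl
  · intro j _ hj
    exact if_neg fun h => hj (Fin.ext (by simp; omega))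
  · simp

lemma coord_of_lt {k : ℕ} (hk : n < k) (s : Fin n → ℂ) : coord n k s = 0 := by
  rw [coord, Finset.sum_eq_zero, zero_apply]
  intro j _
  exact if_neg (by have := j.2; omega)

/-- The `k`-th power sum, expressed through the elementary symmetric polynomials by Newton's
recursion. -/
def newtonSum (n : ℕ) : ℕ → (Fin n → ℂ) → ℂ
  | k => fun s => (-1) ^ (k + 1) * k * coord n k s -
      ∑ i : Fin (k - 1), (-1) ^ ((i : ℕ) + 1) * coord n ((i : ℕ) + 1) s *
        newtonSum n (k - ((i : ℕ) + 1)) s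
  termination_by k => k
  decreasing_by have := i.2; omega

lemma newtonSum_zero (k : ℕ) : newtonSum n k 0 = 0 := by
  rw [newtonSum]
  simp

lemma differentiable_newtonSum (k : ℕ) : Differentiable ℂ (newtonSum n k) := by
  induction k using Nat.strong_induction_on with
  | _ k ih =>
    have h (i : Fin (k - 1)) : Differentiable ℂ (newtonSum n (k - ((i : ℕ) + 1))) :=
      ih _ (by have := i.2; omega)
    rw [newtonSum]
    refine ((coord n k).differentiable.const_mul _).fun_sub (Differentiable.fun_sum fun i _ => ?_)
    exact ((coord n _).differentiable.const_mul _).fun_mul (h i)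

lemma hasFDerivAt_mul_of_eq_zero {E : Type*} [NormedAddCommGroup E] [NormedSpace ℂ E]
    {u v : E → ℂ} {x : E} (hu : DifferentiableAt ℂ u x) (hv : DifferentiableAt ℂ v x)
    (hu0 : u x = 0) (hv0 : v x = 0) : HasFDerivAt (fun y => u y * v y) (0 : E →L[ℂ] ℂ) x := by
  refine (hu.hasFDerivAt.fun_mul hv.hasFDerivAt).congr_fderiv ?_
  ext y
  simp [hu0, hv0]

/-- In Newton's recursion every product has two factors vanishing at `0`, so only the leading term
contributes. -/
lemma hasFDerivAt_newtonSum (k : ℕ) :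
    HasFDerivAt (newtonSum n k) (((-1) ^ (k + 1) * k : ℂ) • coord n k) 0 := by
  have h (i : Fin (k - 1)) : HasFDerivAt (fun s => (-1) ^ ((i : ℕ) + 1) * coord n ((i : ℕ) + 1) s *
        newtonSum n (k - ((i : ℕ) + 1)) s) (0 : (Fin n → ℂ) →L[ℂ] ℂ) 0 :=
    hasFDerivAt_mul_of_eq_zero (((coord n _).differentiable 0).const_mul _)
      (differentiable_newtonSum _ 0) (by simp) (newtonSum_zero _)
  rw [newtonSum]
  simpa using ((coord n k).hasFDerivAt.const_mul ((-1) ^ (k + 1) * k : ℂ)).fun_sub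
    (HasFDerivAt.fun_sum fun i (_ : i ∈ Finset.univ) => h i)

lemma aeval_esymm_eq_coord (z : Fin n → ℂ) {m : ℕ} (hm : 1 ≤ m) :
    MvPolynomial.aeval z (MvPolynomial.esymm (Fin n) ℂ m) = coord n m (sigma n z) := by
  rw [MvPolynomial.aeval_esymm_eq_multiset_esymm, Finset.esymm_map_val]
  by_cases h : m ≤ n
  · rw [coord_apply hm h, sigma]
    simp only [Nat.sub_add_cancel hm]
  · rw [coord_of_lt (by omega), Finset.powersetCard_eq_empty.2 (by simp; omega), Finset.sum_empty]

lemma newtonSum_sigma (z : Fin n → ℂ) {k : ℕ} (hk : k ≠ 0) :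
    newtonSum n k (sigma n z) = ∑ i, z i ^ k := by
  induction k using Nat.strong_induction_on with
  | _ k ih =>
    have h := congrArg (MvPolynomial.aeval z)
      (MvPolynomial.psum_eq_mul_esymm_sub_sum (Fin n) ℂ k (Nat.pos_of_ne_zero hk))
    simp only [map_sub, map_mul, map_sum, map_pow, map_neg, map_one, map_natCast] at h
    have hp (m : ℕ) : MvPolynomial.aeval z (MvPolynomial.psum (Fin n) ℂ m) = ∑ i, z i ^ m := by
      simp [MvPolynomial.psum]
    rw [hp, aeval_esymm_eq_coord z (Nat.one_le_iff_ne_zero.2 hk)] at h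
    rw [newtonSum, h]
    refine congrArg₂ (· - ·) rfl ?_
    refine Finset.sum_bij (fun i _ => ((i : ℕ) + 1, k - ((i : ℕ) + 1))) ?_ ?_ ?_ ?_
    · intro i _
      have := i.2
      simp only [Finset.mem_filter, Finset.HasAntidiagonal.mem_antidiagonal, Set.mem_Ioo]
      omega
    · intro i _ i' _ hii
      exact Fin.ext (Nat.succ_injective (Prod.mk.inj hii).1)
    · rintro ⟨a, b⟩ hab
      simp only [Finset.mem_filter, Finset.HasAntidiagonal.mem_antidiagonal, Set.mem_Ioo] at hab
      refine ⟨⟨a - 1, by omega⟩, Finset.mem_univ _, Prod.ext ?_ ?_⟩ <;> simp <;> omega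
    · intro i _
      have := i.2
      simp only [hp]
      rw [ih _ (by omega) (by omega), aeval_esymm_eq_coord z (by omega)]

/-- Summing `w_i^j` over `0 ≤ j < k` first gives `k` if `w_i = 1` and `0` otherwise; summing over
`i` first gives `n`. Thus `n` is `k` times the number of `i` with `w_i = 1`. -/
lemma sum_pow_eq_zero_imp_dvd {k : ℕ} (hk : 1 ≤ k) (w : Fin n → ℂ) (hw : ∀ i, w i ^ k = 1)
    (h : ∀ j ∈ Finset.Ico 1 k, ∑ i, w i ^ j = 0) : k ∣ n := by
  have h1 : ∑ i, ∑ j ∈ Finset.range k, w i ^ j = n := by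
    rw [Finset.sum_comm, Finset.range_eq_Ico, Finset.sum_eq_sum_Ico_succ_bot hk,
      Finset.sum_congr rfl (fun j hj => h j (by simpa using hj))]
    simp
  have h2 (i : Fin n) : ∑ j ∈ Finset.range k, w i ^ j = if w i = 1 then (k : ℂ) else 0 := by
    split_ifs with hi
    · simp [hi]
    · rw [geom_sum_eq hi, hw, sub_self, zero_div]
  rw [Finset.sum_congr rfl fun i _ => h2 i, ← Finset.sum_filter, Finset.sum_const,
    nsmul_eq_mul] at h1
  exact ⟨_, by rw [mul_comm]; exact_mod_cast h1.symm⟩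

/-- If `g` is bounded by one on a compact set and `q` points strictly outwards wherever `|g| = 1`,
then `g - ε q` is strictly smaller than one for some `ε`. -/
lemma exists_norm_sub_mul_lt_one {T : Type*} [TopologicalSpace T] {K : Set T} (hK : IsCompact K)
    {g q : T → ℂ} (hg : Continuous g) (hq : Continuous q) (hg1 : ∀ x ∈ K, ‖g x‖ ≤ 1)
    (hgq : ∀ x ∈ K, ‖g x‖ = 1 → 0 < (starRingEnd ℂ (g x) * q x).re) :
    ∃ ε : ℝ, ∃ M : ℝ, 0 < M ∧ M < 1 ∧ ∀ x ∈ K, ‖g x - ε * q x‖ ≤ M := by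
  set h : T → ℝ := fun x => (starRingEnd ℂ (g x) * q x).re with hh
  have hcont : Continuous h :=
    Complex.continuous_re.comp ((Complex.continuous_conj.comp hg).mul hq)
  -- Where `q` does not point outwards, `|g|` stays away from one by compactness.
  obtain ⟨δ, hδ, hδK⟩ : ∃ δ : ℝ, 0 < δ ∧ ∀ x ∈ K ∩ h ⁻¹' Iic 0, δ ≤ 1 - ‖g x‖ ^ 2 := by
    refine (hK.inter_right (isClosed_Iic.preimage hcont)).exists_forall_le'
      (by fun_prop) fun x hx => ?_
    have h1 : ‖g x‖ < 1 := lt_of_le_of_ne (hg1 x hx.1) fun h => (hgq x hx.1 h).not_ge hx.2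
    have := norm_nonneg (g x)
    nlinarith
  obtain ⟨H, hH⟩ := hK.exists_bound_of_continuousOn hcont.continuousOn
  obtain ⟨B, hB⟩ := hK.exists_bound_of_continuousOn hq.continuousOn
  have hgsq : ∀ x ∈ K, 0 ≤ 1 - ‖g x‖ ^ 2 := fun x hx => by
    have := hg1 x hx
    have := norm_nonneg (g x)
    nlinarith
  -- The weight `N` makes `N(1 - |g|²) + h` positive on all of `K`: the first term dominates where
  -- `h ≤ 0`.
  set N : ℝ := (|H| + 1) / δ with hN
  have hN0 : 0 < N := by positivity
  obtain ⟨η, hη, hηK⟩ : ∃ η : ℝ, 0 < η ∧ ∀ x ∈ K, η ≤ N * (1 - ‖g x‖ ^ 2) + h x := by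
    refine hK.exists_forall_le' (by fun_prop) fun x hx => ?_
    by_cases hx0 : h x ≤ 0
    · have h1 := mul_le_mul_of_nonneg_left (hδK x ⟨hx, hx0⟩) hN0.le
      rw [hN, div_mul_cancel₀ _ hδ.ne', ← hN] at h1
      have h2 := hH x hx
      rw [Real.norm_eq_abs] at h2
      have := neg_abs_le (h x)
      have := le_abs_self H
      linarith
    · have := mul_nonneg hN0.le (hgsq x hx)
      linarith
  -- Enlarging the weight absorbs the term `ε²|q|²` in `|g - εq|²` for `ε = 1/(2N')`.
  set N' : ℝ := N + B ^ 2 / η with hN'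
  have hN'0 : 0 < N' := by positivity
  have hBN : B ^ 2 ≤ η * N' := by
    rw [hN', mul_add, mul_div_cancel₀ _ hη.ne']
    linarith [mul_pos hη hN0]
  have key : ∀ x ∈ K, ‖g x - (1 / (2 * N') : ℝ) * q x‖ < 1 := fun x hx => by
    have e : ‖g x - (1 / (2 * N') : ℝ) * q x‖ ^ 2 =
        ‖g x‖ ^ 2 - h x / N' + ‖q x‖ ^ 2 / (4 * N' ^ 2) := by
      simp only [hh, ← Complex.normSq_eq_norm_sq, Complex.normSq_apply, Complex.sub_re,
        Complex.sub_im, Complex.mul_re, Complex.mul_im, Complex.ofReal_re, Complex.ofReal_im,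
        Complex.conj_re, Complex.conj_im]
      field_simp
      ring
    have h1 : η ≤ N' * (1 - ‖g x‖ ^ 2) + h x :=
      (hηK x hx).trans (add_le_add_left (mul_le_mul_of_nonneg_right
        (by rw [hN']; linarith [div_nonneg (sq_nonneg B) hη.le]) (hgsq x hx)) _)
    have h2 : ‖q x‖ ^ 2 ≤ η * N' :=
      (pow_le_pow_left₀ (norm_nonneg _) (hB x hx) 2).trans hBN
    have h3 : ‖g x - (1 / (2 * N') : ℝ) * q x‖ ^ 2 < 1 := by
      rw [e, ← sub_pos]
      have : 1 - (‖g x‖ ^ 2 - h x / N' + ‖q x‖ ^ 2 / (4 * N' ^ 2)) =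
          (4 * N' * (N' * (1 - ‖g x‖ ^ 2) + h x) - ‖q x‖ ^ 2) / (4 * N' ^ 2) := by
        field_simp
        ring
      rw [this]
      refine div_pos ?_ (by positivity)
      nlinarith [mul_pos hη hN'0, mul_le_mul_of_nonneg_left h1 hN'0.le]
    exact (sq_lt_one_iff₀ (norm_nonneg _)).1 h3
  obtain ⟨c, hc, hcK⟩ := hK.exists_forall_le' (a := 0)
    (f := fun x => 1 - ‖g x - (1 / (2 * N') : ℝ) * q x‖)
    (by fun_prop) (fun x hx => sub_pos.2 (key x hx))
  refine ⟨1 / (2 * N'), max (1 - c) (1 / 2), by positivity, max_lt (by linarith) (by norm_num),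
    fun x hx => le_max_of_le_left ?_⟩
  have := hcK x hx
  linarith

/-- A sum of numbers of the closed unit disc has maximal modulus only if all of them are equal. -/
lemma eq_of_norm_sum_eq {c : Fin n → ℂ} (hc : ∀ i, ‖c i‖ ≤ 1) (h : ‖∑ i, c i‖ = n) (i : Fin n) :
    c i = (∑ i, c i) / n ∧ ‖c i‖ = 1 := by
  set S := ∑ i, c i with hS
  have hn0 : (0 : ℝ) < n := by exact_mod_cast i.pos
  have hn0C : (n : ℂ) ≠ 0 := by exact_mod_cast hn0.ne'
  -- The total is `n² - |S|² = 0`, while each summand is nonnegative; hence all of them vanish.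
  have hsum : ∑ i, (n - (starRingEnd ℂ S * c i).re) = 0 := by
    rw [Finset.sum_sub_distrib, ← Complex.re_sum, ← Finset.mul_sum, ← hS, mul_comm,
      Complex.mul_conj, Complex.normSq_eq_norm_sq, h, Complex.ofReal_re]
    simp
    ring
  have hle (i : Fin n) : 0 ≤ n - (starRingEnd ℂ S * c i).re := by
    have := Complex.re_le_norm (starRingEnd ℂ S * c i)
    rw [norm_mul, RCLike.norm_conj, h] at this
    nlinarith [hc i]
  have h1 := (Finset.sum_eq_zero_iff_of_nonneg fun i _ => hle i).1 hsum i (Finset.mem_univ i)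
  have h2 : ‖c i - S / n‖ ^ 2 = ‖c i‖ ^ 2 + ‖S‖ ^ 2 / n ^ 2 - 2 / n * (starRingEnd ℂ S * c i).re := by
    have : S / n = ((1 / n : ℝ) : ℂ) * S := by push_cast; ring
    rw [this]
    simp only [← Complex.normSq_eq_norm_sq, Complex.normSq_apply, Complex.sub_re,
      Complex.sub_im, Complex.mul_re, Complex.mul_im, Complex.ofReal_re, Complex.ofReal_im,
      Complex.conj_re, Complex.conj_im]
    field_simp
    ring
  rw [h, (by linarith : (starRingEnd ℂ S * c i).re = n), div_self (by positivity),
    div_mul_cancel₀ _ hn0.ne'] at h2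
  have h3 : ‖c i‖ ^ 2 ≤ 1 := pow_le_one₀ (norm_nonneg _) (hc i)
  have h4 : c i - S / n = 0 := by
    rw [← norm_eq_zero]
    nlinarith [norm_nonneg (c i - S / n)]
  refine ⟨sub_eq_zero.1 h4, ?_⟩
  rw [sub_eq_zero.1 h4, norm_div, h, Complex.norm_natCast, div_self hn0.ne']

/-- Maximality forces every `z_i^k` to equal one unimodular `c`. Then `p_{k-j}` is `c` times the
conjugate of `p_j`, so the expression is `∑ |p_j|²`, which cannot vanish unless `k ∣ n`. -/
lemma re_conj_mul_sum_pos {k : ℕ} (hk : 1 ≤ k) (hkn : ¬ k ∣ n) {z : Fin n → ℂ}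
    (hz : ∀ i, ‖z i‖ ≤ 1) (h : ‖(∑ i, z i ^ k) / n‖ = 1) :
    0 < (starRingEnd ℂ ((∑ i, z i ^ k) / n) *
      ∑ j ∈ Finset.Ico 1 k, (∑ i, z i ^ j) * ∑ i, z i ^ (k - j)).re := by
  have hn : n ≠ 0 := by rintro rfl; exact hkn (dvd_zero k)
  have hn0 : (n : ℝ) ≠ 0 := by exact_mod_cast hn
  set S := ∑ i, z i ^ k with hS
  rw [norm_div, Complex.norm_natCast, div_eq_one_iff_eq hn0] at h
  have heq := eq_of_norm_sum_eq (fun i => by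
    rw [norm_pow]; exact pow_le_one₀ (norm_nonneg _) (hz i)) h
  rw [← hS] at heq
  set c := S / n with hc
  have hz1 (i : Fin n) : ‖z i‖ = 1 := by
    have := (heq i).2
    rw [norm_pow] at this
    exact (pow_eq_one_iff_of_nonneg (norm_nonneg _) (by omega)).1 this
  have hcc : starRingEnd ℂ c * c = 1 := by
    have i : Fin n := ⟨0, Nat.pos_of_ne_zero hn⟩
    rw [← (heq i).1, mul_comm, Complex.mul_conj, Complex.normSq_eq_norm_sq, (heq i).2]
    simp
  have hterm (j : ℕ) (hj : j ∈ Finset.Ico 1 k) :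
      starRingEnd ℂ c * ((∑ i, z i ^ j) * ∑ i, z i ^ (k - j)) =
        ((‖∑ i, z i ^ j‖ ^ 2 : ℝ) : ℂ) := by
    have e : ∑ i, z i ^ (k - j) = c * starRingEnd ℂ (∑ i, z i ^ j) := by
      rw [map_sum, Finset.mul_sum]
      refine Finset.sum_congr rfl fun i _ => ?_
      have hzz : z i ^ j * starRingEnd ℂ (z i ^ j) = 1 := by
        rw [Complex.mul_conj, Complex.normSq_eq_norm_sq, norm_pow, hz1]
        simp
      rw [← (heq i).1, ← Nat.sub_add_cancel (Finset.mem_Ico.1 hj).2.le, pow_add, mul_assoc,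
        Nat.add_sub_cancel, hzz, mul_one]
    rw [e, ← Complex.normSq_eq_norm_sq, ← Complex.mul_conj]
    linear_combination ((∑ i, z i ^ j) * starRingEnd ℂ (∑ i, z i ^ j)) * hcc
  rw [Finset.mul_sum, Finset.sum_congr rfl hterm, ← Complex.ofReal_sum, Complex.ofReal_re]
  refine lt_of_le_of_ne (Finset.sum_nonneg fun j _ => by positivity) fun h0 => hkn ?_
  have h0' := (Finset.sum_eq_zero_iff_of_nonneg fun j _ => by positivity).1 h0.symm
  have i0 : Fin n := ⟨0, Nat.pos_of_ne_zero hn⟩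
  have hzi0 : z i0 ≠ 0 := fun h => by simpa [h] using hz1 i0
  -- Dividing by one coordinate turns the `k`-th roots of `c` into `k`-th roots of unity.
  refine sum_pow_eq_zero_imp_dvd hk (fun i => z i / z i0) (fun i => ?_) fun j hj => ?_
  · rw [div_pow, (heq i).1, (heq i0).1, div_self]
    rw [← (heq i0).1]
    exact pow_ne_zero _ hzi0
  · simp only [div_pow]
    rw [← Finset.sum_div, div_eq_zero_iff]
    exact Or.inl (norm_eq_zero.1 (pow_eq_zero_iff two_ne_zero |>.1 (h0' j hj)))

lemma rho_lt_caratheodory_stdVec {k : ℕ} (hk : 1 ≤ k) (hkn : k ≤ n) (h : ¬ k ∣ n) :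
    rho n (stdVec n k) < caratheodory (symPolydisc n) 0 (stdVec n k) := by
  have hn0 : (0 : ℝ) < n := by exact_mod_cast (by omega : 0 < n)
  have hk0 : (0 : ℝ) < k := by exact_mod_cast hk
  obtain ⟨ε, M, hM0, hM1, hM⟩ := exists_norm_sub_mul_lt_one
    (isCompact_closedBall (0 : Fin n → ℂ) 1)
    (g := fun z => (∑ i, z i ^ k) / n)
    (q := fun z => ∑ j ∈ Finset.Ico 1 k, (∑ i, z i ^ j) * ∑ i, z i ^ (k - j))
    (by fun_prop) (by fun_prop)
    (fun z hz => by
      rw [norm_div, Complex.norm_natCast, div_le_one hn0]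
      refine (norm_sum_le_of_le _ (fun i _ => ?_)).trans_eq (by simp : ∑ i : Fin n, (1 : ℝ) = n)
      rw [norm_pow]
      exact pow_le_one₀ (norm_nonneg _) ((norm_le_pi_norm z i).trans (by simpa using hz)))
    (fun z hz => re_conj_mul_sum_pos hk h
      fun i => (norm_le_pi_norm z i).trans (by simpa using hz))
  -- Since `M < r < 1`, division by `r` keeps the values in the open disc and strictly enlarges the
  -- derivative.
  obtain ⟨r, hMr, hr1⟩ := exists_between hM1
  have hr0 : 0 < r := hM0.trans hMr
  set f : (Fin n → ℂ) → ℂ := fun s => (r : ℂ)⁻¹ * ((n : ℂ)⁻¹ * newtonSum n k s -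
    ε * ∑ j ∈ Finset.Ico 1 k, newtonSum n j s * newtonSum n (k - j) s) with hf
  have hprod : HasFDerivAt (fun s => ∑ j ∈ Finset.Ico 1 k,
      newtonSum n j s * newtonSum n (k - j) s) (0 : (Fin n → ℂ) →L[ℂ] ℂ) 0 := by
    simpa using HasFDerivAt.fun_sum fun j (_ : j ∈ Finset.Ico 1 k) =>
      hasFDerivAt_mul_of_eq_zero (differentiable_newtonSum (n := n) j 0)
        (differentiable_newtonSum (k - j) 0) (newtonSum_zero _) (newtonSum_zero _)
  have hfd : HasFDerivAt f ((r : ℂ)⁻¹ • ((n : ℂ)⁻¹ • ((-1) ^ (k + 1) * k : ℂ) • coord n k -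
      (ε : ℂ) • (0 : (Fin n → ℂ) →L[ℂ] ℂ))) 0 :=
    (((hasFDerivAt_newtonSum k).const_mul _).fun_sub (hprod.const_mul _)).const_mul _
  have hdiff : Differentiable ℂ f :=
    (((differentiable_newtonSum k).const_mul _).fun_sub ((Differentiable.fun_sum fun j _ =>
      (differentiable_newtonSum j).fun_mul (differentiable_newtonSum (k - j))).const_mul
        _)).const_mul _
  have hval : ‖fderiv ℂ f 0 (stdVec n k)‖ = r⁻¹ * (k / n) := by
    rw [hfd.fderiv]
    simp [coord_apply hk hkn, stdVec, Nat.sub_add_cancel hk, abs_of_pos hr0]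
    exact Or.inl (by ring)
  have hmaps : MapsTo f (symPolydisc n) (ball 0 1) := by
    rintro _ ⟨z, hz, rfl⟩
    have hz1 : z ∈ closedBall (0 : Fin n → ℂ) 1 := by
      rw [mem_closedBall_zero_iff, pi_norm_le_iff_of_nonneg zero_le_one]
      exact fun i => (hz i).le
    have e : f (sigma n z) = (r : ℂ)⁻¹ * ((∑ i, z i ^ k) / n -
        ε * ∑ j ∈ Finset.Ico 1 k, (∑ i, z i ^ j) * ∑ i, z i ^ (k - j)) := by
      simp only [hf]
      rw [newtonSum_sigma z (by omega), div_eq_inv_mul]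
      congr 3
      refine Finset.sum_congr rfl fun j hj => ?_
      have := Finset.mem_Ico.1 hj
      rw [newtonSum_sigma z (by omega), newtonSum_sigma z (by omega)]
    rw [mem_ball_zero_iff, e, norm_mul, norm_inv, Complex.norm_real, Real.norm_of_nonneg hr0.le,
      inv_mul_lt_iff₀ hr0, mul_one]
    exact (hM z hz1).trans_lt hMr
  have hle := le_caratheodory (symPolydisc_mem_nhds n) hdiff.differentiableOn hmaps
    (by simp [hf, newtonSum_zero]) (stdVec n k)
  rw [hval] at hle
  rw [rho_stdVec hk hkn]
  refine lt_of_lt_of_le ?_ hle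
  exact lt_mul_of_one_lt_left (div_pos hk0 hn0) ((one_lt_inv₀ hr0).2 hr1)

/-! ### The strict inequality for the Kobayashi metric -/

/-- The **Schwarz--Pick lemma** at the origin. -/
lemma norm_deriv_le_one_sub_sq {h : ℂ → ℂ} (hd : DifferentiableOn ℂ h (ball 0 1))
    (hb : ∀ ζ ∈ ball (0 : ℂ) 1, ‖h ζ‖ ≤ 1) : ‖deriv h 0‖ ≤ 1 - ‖h 0‖ ^ 2 := by
  have h0 : (0 : ℂ) ∈ ball (0 : ℂ) 1 := by simp
  -- Scaling by `r < 1` keeps the Möbius denominator nonzero although `|h|` may equal one; then `r`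
  -- tends to one.
  have key (r : ℝ) (hr0 : 0 < r) (hr1 : r < 1) :
      r * ‖deriv h 0‖ ≤ 1 - r ^ 2 * ‖h 0‖ ^ 2 := by
    set a : ℂ := r * h 0 with ha
    set u : ℂ → ℂ := fun ζ => (r * h ζ - a) * (1 - starRingEnd ℂ a * (r * h ζ))⁻¹ with hu
    have hrh : ∀ ζ ∈ ball (0 : ℂ) 1, ‖r * h ζ‖ < 1 := fun ζ hζ => by
      rw [norm_mul, Complex.norm_real, Real.norm_of_nonneg hr0.le]
      exact (mul_le_of_le_one_right hr0.le (hb ζ hζ)).trans_lt hr1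
    have ha1 : ‖a‖ < 1 := hrh 0 h0
    have hne : ∀ ζ ∈ ball (0 : ℂ) 1, 1 - starRingEnd ℂ a * (r * h ζ) ≠ 0 := fun ζ hζ h2 => by
      have h1 : ‖starRingEnd ℂ a * (r * h ζ)‖ < 1 := by
        rw [norm_mul, RCLike.norm_conj]
        exact mul_lt_one_of_nonneg_of_lt_one_left (norm_nonneg _) ha1 (hrh ζ hζ).le
      rw [← sub_eq_zero.1 h2, norm_one] at h1
      exact lt_irrefl _ h1
    have hud : DifferentiableOn ℂ u (ball 0 1) :=
      ((hd.const_mul (r : ℂ)).sub_const a).fun_mul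
        ((((hd.const_mul (r : ℂ)).const_mul _).const_sub 1).fun_inv hne)
    have hu0 : u 0 = 0 := by simp [hu, ha]
    have hmaps : MapsTo u (ball 0 1) (closedBall (u 0) 1) := fun ζ hζ => by
      rw [hu0, mem_closedBall_zero_iff, hu, norm_mul, norm_inv, ← div_eq_mul_inv,
        div_le_one (norm_pos_iff.2 (hne ζ hζ)), ← abs_norm, ← abs_norm (1 - _), ← sq_le_sq]
      have e : ‖1 - starRingEnd ℂ a * (r * h ζ)‖ ^ 2 - ‖r * h ζ - a‖ ^ 2 =
          (1 - ‖a‖ ^ 2) * (1 - ‖r * h ζ‖ ^ 2) := by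
        simp only [← Complex.normSq_eq_norm_sq, Complex.normSq_apply, Complex.sub_re,
          Complex.sub_im, Complex.mul_re, Complex.mul_im, Complex.conj_re, Complex.conj_im,
          Complex.one_re, Complex.one_im]
        ring
      have h1 := hrh ζ hζ
      have h2 : 0 ≤ (1 - ‖a‖ ^ 2) * (1 - ‖r * h ζ‖ ^ 2) :=
        mul_nonneg (sub_nonneg.2 (pow_le_one₀ (norm_nonneg _) ha1.le))
          (sub_nonneg.2 (pow_le_one₀ (norm_nonneg _) h1.le))
      linarith
    have hh : HasDerivAt h (deriv h 0) 0 :=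
      ((hd 0 h0).differentiableAt (isOpen_ball.mem_nhds h0)).hasDerivAt
    have hder : HasDerivAt u (r * deriv h 0 * (1 - starRingEnd ℂ a * a)⁻¹) 0 := by
      have h1 := ((hh.const_mul (r : ℂ)).sub_const a).fun_mul
        (((((hh.const_mul (r : ℂ)).const_mul (starRingEnd ℂ a)).const_sub 1)).fun_inv
          (hne 0 h0))
      exact h1.congr_deriv (by rw [← ha, sub_self, zero_mul, add_zero])
    have hS := Complex.norm_deriv_le_one_of_mapsTo_ball hud hmaps one_pos
    have hpos : 0 < 1 - ‖a‖ ^ 2 := by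
      have := norm_nonneg a
      nlinarith
    have e : 1 - starRingEnd ℂ a * a = ((1 - ‖a‖ ^ 2 : ℝ) : ℂ) := by
      rw [mul_comm, Complex.mul_conj, Complex.normSq_eq_norm_sq]
      push_cast
      ring
    rw [hder.deriv, e, norm_mul, norm_mul, norm_inv, Complex.norm_real, Complex.norm_real,
      Real.norm_of_nonneg hr0.le, Real.norm_of_nonneg hpos.le, ← div_eq_mul_inv,
      div_le_one hpos] at hS
    rw [ha, norm_mul, Complex.norm_real, Real.norm_of_nonneg hr0.le, mul_pow] at hS
    exact hS
  have hlim : Filter.Tendsto (fun r : ℝ => 1 - r ^ 2 * ‖h 0‖ ^ 2 - r * ‖deriv h 0‖)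
      (nhdsWithin 1 (Iio 1)) (nhds (1 - 1 ^ 2 * ‖h 0‖ ^ 2 - 1 * ‖deriv h 0‖)) :=
    (Continuous.tendsto (by fun_prop) 1).mono_left nhdsWithin_le_nhds
  have := ge_of_tendsto hlim (b := 0) (by
    filter_upwards [Ioo_mem_nhdsLT (zero_lt_one' ℝ)] with r hr
    linarith [key r hr.1 hr.2])
  linarith

lemma auxForm_smul (n : ℕ) (t a : ℂ) (X : Fin n → ℂ) :
    auxForm n t (a • X) = a * auxForm n t X := by
  simp only [auxForm, Pi.smul_apply, smul_eq_mul, ← mul_div_assoc, Finset.mul_sum]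
  congr 1
  exact Finset.sum_congr rfl fun j _ => by ring

/-- `linForm n t` as a continuous linear map. -/
def linFormCLM (n : ℕ) (t : ℂ) : (Fin n → ℂ) →L[ℂ] ℂ :=
  LinearMap.toContinuousLinearMap
    { toFun := linForm n t
      map_add' := linForm_add n t
      map_smul' := linForm_smul n t }

/-- The second order Schwarz--Pick condition for a holomorphic disc in the symmetrized polydisc. -/
lemma norm_second_coeff_le (hn : n ≠ 0) {φ : ℂ → Fin n → ℂ}
    (hφ : DifferentiableOn ℂ φ (ball 0 1)) (hφD : MapsTo φ (ball 0 1) (symPolydisc n))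
    (hφ0 : φ 0 = 0) : ∃ Z : Fin n → ℂ, ∀ t : ℂ, ‖t‖ = 1 →
      ‖linForm n t Z - linForm n t (deriv φ 0) * auxForm n t (deriv φ 0)‖ ≤
        1 - ‖linForm n t (deriv φ 0)‖ ^ 2 := by
  have h0 : (0 : ℂ) ∈ ball (0 : ℂ) 1 := by simp
  set ψ := dslope φ 0 with hψ
  have hψd : DifferentiableOn ℂ ψ (ball 0 1) :=
    (Complex.differentiableOn_dslope (isOpen_ball.mem_nhds h0)).2 hφ
  have hφψ (ζ : ℂ) : φ ζ = ζ • ψ ζ := by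
    have := sub_smul_dslope φ 0 ζ
    rw [sub_zero, hφ0, sub_zero] at this
    exact this.symm
  have hψ0 : ψ 0 = deriv φ 0 := dslope_same φ 0
  have hψh : HasDerivAt ψ (deriv ψ 0) 0 :=
    ((hψd 0 h0).differentiableAt (isOpen_ball.mem_nhds h0)).hasDerivAt
  -- The witness is the second Taylor coefficient of `φ`; it does not depend on `t`, which the later
  -- averaging needs.
  refine ⟨deriv ψ 0, fun t ht => ?_⟩
  rw [← hψ0]
  set h : ℂ → ℂ := fun ζ => linForm n t (ψ ζ) * (1 + ζ * auxForm n t (ψ ζ))⁻¹ with hh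
  have hne : ∀ ζ ∈ ball (0 : ℂ) 1, 1 + ζ * auxForm n t (ψ ζ) ≠ 0 := fun ζ hζ => by
    have := one_add_auxForm_ne_zero hn ht (hφD hζ)
    rwa [hφψ, auxForm_smul] at this
  have hM : DifferentiableOn ℂ (fun ζ => auxForm n t (ψ ζ)) (ball 0 1) :=
    (differentiable_auxForm n t).comp_differentiableOn hψd
  have hd : DifferentiableOn ℂ h (ball 0 1) :=
    ((differentiable_linForm n t).comp_differentiableOn hψd).fun_mul
      (((differentiableOn_id.fun_mul hM).const_add 1).fun_inv hne)
  have hprod : ∀ ζ ∈ ball (0 : ℂ) 1, ‖ζ * h ζ‖ ≤ 1 := fun ζ hζ => by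
    have h1 := norm_linForm_lt hn ht (hφD hζ)
    have h2 := norm_pos_iff.2 (one_add_auxForm_ne_zero hn ht (hφD hζ))
    have e : ζ * h ζ = linForm n t (φ ζ) / (1 + auxForm n t (φ ζ)) := by
      rw [hφψ, auxForm_smul, linForm_smul, hh, div_eq_mul_inv, mul_assoc]
    rw [e, norm_div, div_le_one h2]
    exact h1.le
  have hb : ∀ ζ ∈ ball (0 : ℂ) 1, ‖h ζ‖ ≤ 1 := fun ζ hζ => by
    have hg : DifferentiableOn ℂ (fun ζ => ζ * h ζ) (ball 0 1) := differentiableOn_id.fun_mul hd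
    have h1 := Complex.norm_dslope_le_div_of_mapsTo_ball (R₁ := 1) (R₂ := 1) hg
      (fun w hw => by simpa using hprod w hw) hζ
    have e : dslope (fun ζ => ζ * h ζ) 0 ζ = h ζ := by
      rcases eq_or_ne ζ 0 with rfl | hζ0
      · have hh0 : HasDerivAt h (deriv h 0) 0 :=
          ((hd 0 h0).differentiableAt (isOpen_ball.mem_nhds h0)).hasDerivAt
        rw [dslope_same, ((hasDerivAt_id' (0 : ℂ)).fun_mul hh0).deriv]
        simp
      · rw [dslope_of_ne _ hζ0, slope_def_field]
        field_simp
        simp [mul_comm]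
    rwa [e, div_one] at h1
  have hSP := norm_deriv_le_one_sub_sq hd hb
  have hL : HasDerivAt (fun ζ => linForm n t (ψ ζ)) (linForm n t (deriv ψ 0)) 0 :=
    (linFormCLM n t).hasFDerivAt.comp_hasDerivAt 0 hψh
  have hM0 := ((hM 0 h0).differentiableAt (isOpen_ball.mem_nhds h0)).hasDerivAt
  have hder : HasDerivAt h
      (linForm n t (deriv ψ 0) - linForm n t (ψ 0) * auxForm n t (ψ 0)) 0 :=
    (hL.fun_mul ((((hasDerivAt_id' (0 : ℂ)).fun_mul hM0).const_add 1).fun_inv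
      (hne 0 h0))).congr_deriv (by simp; ring)
  have e0 : h 0 = linForm n t (ψ 0) := by simp [hh]
  rwa [hder.deriv, e0] at hSP

/-! ### The directions spanned by `e_1` and `e_n`. -/

lemma linForm_smul_stdVec_add (hn : 2 ≤ n) (t a b : ℂ) :
    linForm n t (a • stdVec n 1 + b • stdVec n n) = a / n + b * t ^ (n - 1) := by
  have hn' : (n : ℂ) ≠ 0 := by exact_mod_cast (by omega : n ≠ 0)
  rw [linForm_add, linForm_smul, linForm_smul, linForm_stdVec le_rfl (by omega),
    linForm_stdVec (by omega) le_rfl]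
  field_simp
  simp

lemma auxForm_smul_stdVec_add (hn : 2 ≤ n) (t a b : ℂ) :
    auxForm n t (a • stdVec n 1 + b • stdVec n n) = (n - 1 : ℕ) * (a / n) * t := by
  rw [auxForm, Finset.sum_eq_single ⟨0, by omega⟩]
  · simp [stdVec, (by omega : n ≠ 1).symm, Nat.cast_sub (by omega : 1 ≤ n)]
    ring
  · intro j _ hj
    have hj0 : (j : ℕ) ≠ 0 := fun h => hj (Fin.ext h)
    by_cases hjn : (j : ℕ) + 1 = n
    · have : ((j : ℂ) + 1) = n := by exact_mod_cast hjn
      rw [this, sub_self, zero_mul, zero_mul]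
    · simp [stdVec, hj0, hjn]
  · simp

/-- Averaging `linForm` over the cosets of the roots of unity extracts the second coordinate. -/
lemma sum_inv_mul_linForm {m : ℕ} (hm : 2 ≤ m) (hmn : n = m + 1) {ω : ℂ}
    (hω : IsPrimitiveRoot ω m) {t : ℂ} (ht : t ≠ 0) (Z : Fin n → ℂ) :
    ∑ i ∈ Finset.range m, (t * ω ^ i)⁻¹ * linForm n (t * ω ^ i) Z =
      m * (2 / n * Z ⟨1, by omega⟩) := by
  have hω0 : ω ≠ 0 := hω.ne_zero (by omega)
  have e1 (i : ℕ) : (t * ω ^ i)⁻¹ * linForm n (t * ω ^ i) Z =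
      ∑ j : Fin n, ((j : ℂ) + 1) * Z j / n * (t ^ (j : ℕ) * t⁻¹) * (ω ^ (j : ℕ) * ω⁻¹) ^ i := by
    rw [linForm, Finset.sum_div, Finset.mul_sum]
    refine Finset.sum_congr rfl fun j _ => ?_
    rw [mul_pow, mul_inv, mul_pow, inv_pow, ← pow_mul, ← pow_mul, mul_comm i]
    ring
  rw [Finset.sum_congr rfl fun i _ => e1 i, Finset.sum_comm]
  simp_rw [← Finset.mul_sum]
  rw [Finset.sum_eq_single ⟨1, by omega⟩]
  · simp [ht, hω0]
    ring
  · intro j _ hj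
    have hj1 : (j : ℕ) ≠ 1 := fun h => hj (Fin.ext h)
    have hx1 : ω ^ (j : ℕ) * ω⁻¹ ≠ 1 := by
      intro h
      have h1 : ω ^ (j : ℕ) = ω ^ 1 := by rw [pow_one, ← mul_inv_eq_one₀ hω0, h]
      rcases lt_or_ge (j : ℕ) m with hjm | hjm
      · exact hj1 (hω.pow_inj hjm (by omega) h1)
      · have hjm' : (j : ℕ) = m := by have := j.2; omega
        rw [hjm', hω.pow_eq_one, ← pow_zero ω] at h1
        exact absurd (hω.pow_inj (by omega) (by omega) h1) (by norm_num)
    have hxm : (ω ^ (j : ℕ) * ω⁻¹) ^ m = 1 := by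
      rw [mul_pow, inv_pow, ← pow_mul, mul_comm, mul_comm (j : ℕ), pow_mul, hω.pow_eq_one,
        one_pow, inv_one, one_mul]
    rw [geom_sum_eq hx1, hxm, sub_self, zero_div, mul_zero]
  · simp

/-- Over all `t` with `t^m = μ` the value of `linForm` at the direction is constant and `auxForm` is
proportional to `t`. Averaging the inequalities after division by `t` leaves only the second
coordinate of `Z`, so the unknown no longer depends on `μ`. -/
lemma norm_sub_mul_add_mul_le {m : ℕ} (hm : 2 ≤ m) (hmn : n = m + 1) {a b : ℂ} {Z : Fin n → ℂ}
    (h : ∀ t : ℂ, ‖t‖ = 1 → ‖linForm n t Z - linForm n t (a • stdVec n 1 + b • stdVec n n) *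
      auxForm n t (a • stdVec n 1 + b • stdVec n n)‖ ≤
        1 - ‖linForm n t (a • stdVec n 1 + b • stdVec n n)‖ ^ 2)
    {μ : ℂ} (hμ : ‖μ‖ = 1) :
    ‖2 / n * Z ⟨1, by omega⟩ - m * (a / n) * (a / n + b * μ)‖ ≤ 1 - ‖a / n + b * μ‖ ^ 2 := by
  have hm0 : (0 : ℝ) < m := by exact_mod_cast (by omega : 0 < m)
  obtain ⟨t, ht⟩ := IsAlgClosed.exists_pow_nat_eq μ (by omega : 0 < m)
  have htn : ‖t‖ = 1 := by
    refine (pow_eq_one_iff_of_nonneg (norm_nonneg _) (by omega : m ≠ 0)).1 ?_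
    rw [← norm_pow, ht, hμ]
  have ht0 : t ≠ 0 := fun h => by simp [h] at htn
  have hω := Complex.isPrimitiveRoot_exp m (by omega)
  set ω := Complex.exp (2 * Real.pi * Complex.I / m)
  have hωn : ‖ω‖ = 1 := hω.norm'_eq_one (by omega)
  have hω0 : ω ≠ 0 := hω.ne_zero (by omega)
  have hL (i : ℕ) : linForm n (t * ω ^ i) (a • stdVec n 1 + b • stdVec n n) = a / n + b * μ := by
    rw [linForm_smul_stdVec_add (by omega), (by omega : n - 1 = m), mul_pow, ht, ← pow_mul,
      mul_comm i, pow_mul, hω.pow_eq_one, one_pow, mul_one]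
  have hterm (i : ℕ) : ‖(t * ω ^ i)⁻¹ * linForm n (t * ω ^ i) Z -
      m * (a / n) * (a / n + b * μ)‖ ≤ 1 - ‖a / n + b * μ‖ ^ 2 := by
    have hx : ‖t * ω ^ i‖ = 1 := by rw [norm_mul, norm_pow, hωn, htn, one_pow, one_mul]
    have hx0 : t * ω ^ i ≠ 0 := mul_ne_zero ht0 (pow_ne_zero _ hω0)
    have h1 := h _ hx
    rw [hL, auxForm_smul_stdVec_add (by omega), (by omega : n - 1 = m)] at h1
    refine le_of_eq_of_le ?_ h1
    rw [← one_mul ‖linForm _ _ _ - _‖, ← inv_one, ← hx, ← norm_inv, ← norm_mul]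
    congr 1
    field_simp
  have hsum : ∑ i ∈ Finset.range m, ((t * ω ^ i)⁻¹ * linForm n (t * ω ^ i) Z -
      m * (a / n) * (a / n + b * μ)) =
        m * (2 / n * Z ⟨1, by omega⟩ - m * (a / n) * (a / n + b * μ)) := by
    rw [Finset.sum_sub_distrib, sum_inv_mul_linForm hm hmn hω ht0, Finset.sum_const,
      Finset.card_range, nsmul_eq_mul, mul_sub]
  have hle := norm_sum_le_of_le (Finset.range m) fun i _ => hterm i
  rw [hsum, norm_mul, Complex.norm_natCast, Finset.sum_const, Finset.card_range,
    nsmul_eq_mul] at hle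
  exact le_of_mul_le_mul_left hle hm0

/-- One `A` must be close to `m p (p + qμ)` for every `μ`. For two values of `μ` near the aligning
one these points are far apart while the allowed radii are small; the triangle inequality eliminates
`A`. -/
lemma sq_add_mul_le_one {m : ℕ} (hm : 2 ≤ m) {p q A : ℂ}
    (h : ∀ μ : ℂ, ‖μ‖ = 1 → ‖A - m * p * (p + q * μ)‖ ≤ 1 - ‖p + q * μ‖ ^ 2) :
    (‖p‖ + ‖q‖) ^ 2 + 4 / 5 * (‖p‖ * ‖q‖) ≤ 1 := by
  obtain ⟨η, hη, halign⟩ := exists_norm_add_pow_mul one_ne_zero p q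
  rw [pow_one] at halign
  have norm34 (s : ℝ) (hs : s ^ 2 = 1) : ‖(⟨3 / 5, s * (4 / 5)⟩ : ℂ)‖ = 1 := by
    rw [Complex.norm_def, Complex.normSq_apply, Real.sqrt_eq_one]
    nlinarith
  -- A conjugate pair of rational points on the circle. They separate the centres by `(8/5) m |p|
  -- |q|` and lower the sum of the `|p + qμ|²` by only `(8/5) |p| |q|` from its maximum, so `m ≥ 2`
  -- yields a gain.
  set v : ℂ := ⟨3 / 5, 1 * (4 / 5)⟩ with hv
  set w : ℂ := ⟨3 / 5, -1 * (4 / 5)⟩ with hw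
  have hv1 : ‖v‖ = 1 := norm34 1 (by norm_num)
  have hw1 : ‖w‖ = 1 := norm34 (-1) (by norm_num)
  have h1 := h (η * v) (by rw [norm_mul, hη, hv1, one_mul])
  have h2 := h (η * w) (by rw [norm_mul, hη, hw1, one_mul])
  have hdiff : ‖(A - m * p * (p + q * (η * w))) - (A - m * p * (p + q * (η * v)))‖ =
      8 / 5 * (m * (‖p‖ * ‖q‖)) := by
    have hvw : v - w = ((8 / 5 : ℝ) : ℂ) * Complex.I := by
      apply Complex.ext <;> simp [hv, hw]
      norm_num
    have e : (A - m * p * (p + q * (η * w))) - (A - m * p * (p + q * (η * v))) =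
        m * p * q * η * (v - w) := by ring
    rw [e, hvw]
    simp only [norm_mul, Complex.norm_natCast, hη, Complex.norm_real, Complex.norm_I,
      Real.norm_eq_abs]
    rw [abs_of_pos (by norm_num : (0 : ℝ) < 8 / 5)]
    ring
  have hsum : ‖p + q * (η * v)‖ ^ 2 + ‖p + q * (η * w)‖ ^ 2 =
      2 * (‖p‖ + ‖q‖) ^ 2 - 8 / 5 * (‖p‖ * ‖q‖) := by
    have e1 : ‖p + q * (η * v)‖ ^ 2 + ‖p + q * (η * w)‖ ^ 2 =
        6 / 5 * ‖p + q * η‖ ^ 2 + 4 / 5 * ‖p‖ ^ 2 + 4 / 5 * ‖q * η‖ ^ 2 := by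
      simp only [hv, hw, ← Complex.normSq_eq_norm_sq, Complex.normSq_apply, Complex.add_re,
        Complex.add_im, Complex.mul_re, Complex.mul_im]
      ring
    rw [e1, halign, norm_mul, hη]
    ring
  have htri := norm_sub_le (A - m * p * (p + q * (η * w))) (A - m * p * (p + q * (η * v)))
  rw [hdiff] at htri
  have hm2 : (2 : ℝ) ≤ m := by exact_mod_cast hm
  have := mul_le_mul_of_nonneg_right hm2 (mul_nonneg (norm_nonneg p) (norm_nonneg q))
  nlinarith

lemma rho_lt_kobayashi_smul_stdVec_add (hn : 3 ≤ n) {a b : ℂ} (ha : a ≠ 0) (hb : b ≠ 0) :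
    rho n (a • stdVec n 1 + b • stdVec n n) <
      kobayashi (symPolydisc n) 0 (a • stdVec n 1 + b • stdVec n n) := by
  have hn0 : (n : ℂ) ≠ 0 := by exact_mod_cast (by omega : n ≠ 0)
  have hp : 0 < ‖a / n‖ := norm_pos_iff.2 (div_ne_zero ha hn0)
  have hq : 0 < ‖b‖ := norm_pos_iff.2 hb
  have hrho : rho n (a • stdVec n 1 + b • stdVec n n) ≤ ‖a / n‖ + ‖b‖ := by
    obtain ⟨t, ht, h⟩ := (rho_isGreatest n (a • stdVec n 1 + b • stdVec n n)).1
    simp only [mem_sphere_iff_norm, sub_zero] at ht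
    rw [← h]
    simp only [linForm_smul_stdVec_add (by omega : 2 ≤ n)]
    refine (norm_add_le _ _).trans_eq ?_
    rw [norm_mul, norm_pow, ht, one_pow, mul_one]
  refine hrho.trans_lt (lt_of_lt_of_le (b := √((‖a / n‖ + ‖b‖) ^ 2 +
    4 / 5 * (‖a / n‖ * ‖b‖))) (Real.lt_sqrt_of_sq_lt ?_) ?_)
  · have := mul_pos hp hq
    linarith
  refine le_csInf (kobayashi_set_nonempty (symPolydisc_mem_nhds n) _) ?_
  rintro r ⟨α, φ, hφ, hφD, hφ0, hX, rfl⟩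
  have hα : α ≠ 0 := by
    rintro rfl
    have := congrFun hX ⟨0, by omega⟩
    simp [stdVec, (by omega : n ≠ 1).symm] at this
    exact ha this.symm
  have hY : deriv φ 0 = (α⁻¹ * a) • stdVec n 1 + (α⁻¹ * b) • stdVec n n := by
    rw [mul_smul, mul_smul, ← smul_add, ← hX, smul_smul, inv_mul_cancel₀ hα, one_smul]
  obtain ⟨Z, hZ⟩ := norm_second_coeff_le (by omega) hφ hφD hφ0
  rw [hY] at hZ
  have hkey := fun (μ : ℂ) (hμ : ‖μ‖ = 1) =>
    norm_sub_mul_add_mul_le (m := n - 1) (by omega : 2 ≤ n - 1) (by omega : n = n - 1 + 1) hZ hμ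
  have h := sq_add_mul_le_one (by omega : 2 ≤ n - 1) hkey
  have hα' : 0 < ‖α‖ := norm_pos_iff.2 hα
  refine Real.sqrt_le_iff.2 ⟨hα'.le, ?_⟩
  rw [mul_div_assoc, norm_mul, norm_mul, norm_inv] at h
  -- The estimate is homogeneous of degree two in the direction, so multiplying by `‖α‖²` undoes the
  -- normalisation.
  have h' := mul_le_mul_of_nonneg_left h (sq_nonneg ‖α‖)
  refine le_of_eq_of_le ?_ (h'.trans_eq (mul_one _))
  have e : ‖α‖ * ‖α‖⁻¹ = 1 := mul_inv_cancel₀ hα'.ne'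
  linear_combination (-((‖a / n‖ + ‖b‖) ^ 2 + 4 / 5 * (‖a / n‖ * ‖b‖)) *
    (‖α‖ * ‖α‖⁻¹ + 1)) * e

lemma rho_lt_kobayashi (hn : 3 ≤ n) {X : Fin n → ℂ}
    (hX : X ∈ Submodule.span ℂ ({stdVec n 1, stdVec n n} : Set (Fin n → ℂ)))
    (h1 : X ∉ Submodule.span ℂ ({stdVec n 1} : Set (Fin n → ℂ)))
    (h2 : X ∉ Submodule.span ℂ ({stdVec n n} : Set (Fin n → ℂ))) :
    rho n X < kobayashi (symPolydisc n) 0 X := by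
  obtain ⟨a, b, rfl⟩ := Submodule.mem_span_pair.1 hX
  refine rho_lt_kobayashi_smul_stdVec_add hn ?_ ?_
  · rintro rfl
    exact h2 (Submodule.mem_span_singleton.2 ⟨b, by simp⟩)
  · rintro rfl
    exact h1 (Submodule.mem_span_singleton.2 ⟨a, by simp⟩)

end SymmetrizedPolydisc

end

theorem theoremi (n : ℕ) (hn : 1 ≤ n) :
    -- (i), first part
    (∀ k : ℕ, k ∣ n →
      SymmetrizedPolydisc.kobayashi (SymmetrizedPolydisc.symPolydisc n) 0
          (SymmetrizedPolydisc.stdVec n k) =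
        SymmetrizedPolydisc.rho n (SymmetrizedPolydisc.stdVec n k) ∧
      SymmetrizedPolydisc.rho n (SymmetrizedPolydisc.stdVec n k) = (k : ℝ) / (n : ℝ)) ∧
    -- (i), second part
    (∀ k l : ℕ, k ∣ n → l ∣ n →
      ∀ X ∈ Submodule.span ℂ
          ({SymmetrizedPolydisc.stdVec n k, SymmetrizedPolydisc.stdVec n l} : Set (Fin n → ℂ)),
        SymmetrizedPolydisc.kobayashiBuseman (SymmetrizedPolydisc.symPolydisc n) 0 X =
          SymmetrizedPolydisc.caratheodory (SymmetrizedPolydisc.symPolydisc n) 0 X ∧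
        SymmetrizedPolydisc.caratheodory (SymmetrizedPolydisc.symPolydisc n) 0 X =
          SymmetrizedPolydisc.rho n X) ∧
    -- (ii)
    (3 ≤ n →
      ∀ X ∈ Submodule.span ℂ
          ({SymmetrizedPolydisc.stdVec n 1, SymmetrizedPolydisc.stdVec n n} : Set (Fin n → ℂ)),
        X ∉ Submodule.span ℂ ({SymmetrizedPolydisc.stdVec n 1} : Set (Fin n → ℂ)) →
        X ∉ Submodule.span ℂ ({SymmetrizedPolydisc.stdVec n n} : Set (Fin n → ℂ)) →
        SymmetrizedPolydisc.rho n X <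
          SymmetrizedPolydisc.kobayashi (SymmetrizedPolydisc.symPolydisc n) 0 X) ∧
    -- (iii)
    (∀ k : ℕ, 1 ≤ k → k ≤ n → ¬ k ∣ n →
      SymmetrizedPolydisc.rho n (SymmetrizedPolydisc.stdVec n k) <
        SymmetrizedPolydisc.caratheodory (SymmetrizedPolydisc.symPolydisc n) 0
          (SymmetrizedPolydisc.stdVec n k)) := by
  have hn0 : n ≠ 0 := by omega
  exact ⟨fun k hk => SymmetrizedPolydisc.kobayashi_stdVec hn0 hk,
    fun k l hk hl X hX => SymmetrizedPolydisc.kobayashiBuseman_eq_caratheodory_eq_rho hn0 hk hl hX,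
    fun h3 X hX h1 h2 => SymmetrizedPolydisc.rho_lt_kobayashi h3 hX h1 h2,
    fun k hk hkn h => SymmetrizedPolydisc.rho_lt_caratheodory_stdVec hk hkn h⟩
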